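/- Let $\mathbb F_q$ be the finite field with $q$ elements, $q$ odd, let $d\ge 2$ and $k\ge 1$ be integers, and for $x\in\mathbb F_q^d$ write $\|x\|=x_1^2+\dots+x_d^2\in\mathbb F_q$. Let $E\subset\mathbb F_q^d$ satisfy $$|E|\ge\frac{4k}{\ln 2}\,q^{\frac{d+1}{2}}.$$ Then the distance graph of $E$ contains a non-overlapping chain of length $k$ of every type; that is, for every sequence $(t_1,\dots,t_k)$ of nonzero elements of $\mathbb F_q$ there are pairwise distinct points $v^1,\dots,v^{k+1}\in E$ such that $\|v^i-v^{i+1}\|=t_i$ for $1\le i\le k$. -/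

import Mathlib

/-- The quadratic form `‖x‖ = x₁² + ⋯ + x_d²` on `F^d`, with values in `F`. -/
def sqNorm {F : Type*} [Field F] {d : ℕ} (x : Fin d → F) : F :=
  ∑ i, x i ^ 2

theorem sqNorm_sub_comm {F : Type*} [Field F] {d : ℕ} (x y : Fin d → F) :
    sqNorm (x - y) = sqNorm (y - x) := by
  unfold sqNorm
  refine Finset.sum_congr rfl fun i _ => ?_
  simp only [Pi.sub_apply]
  ring

/-- The distance graph of `E ⊆ F^d` for the distance `t`: the vertices are the points of `E`,
and two distinct vertices `x`, `y` are joined by an edge when `‖x - y‖ = t`.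
(For `t ≠ 0` the requirement `x ≠ y` is automatic.) -/
def distanceGraph {F : Type*} [Field F] {d : ℕ} (E : Finset (Fin d → F)) (t : F) :
    SimpleGraph E where
  Adj x y := x ≠ y ∧ sqNorm ((x : Fin d → F) - (y : Fin d → F)) = t
  symm := ⟨fun x y h => ⟨h.1.symm, by rw [sqNorm_sub_comm]; exact h.2⟩⟩
  loopless := ⟨fun _ h => h.1 rfl⟩

/-- The sequence `v¹, …, v^{k+1}` of points of `E` is a chain (path) of length `k` and of type
`t = (t₁, …, t_k)`: consecutive points `vⁱ`, `vⁱ⁺¹` are joined at distance `tᵢ`. -/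
def IsChainOfType {F : Type*} [Field F] {d k : ℕ} (E : Finset (Fin d → F)) (t : Fin k → F)
    (v : Fin (k + 1) → E) : Prop :=
  ∀ i : Fin k, (distanceGraph E (t i)).Adj (v i.castSucc) (v i.succ)

/-- A chain of length `k` and type `t` that is non-overlapping: all its `k + 1` vertices are
distinct. -/
def IsNonOverlappingChain {F : Type*} [Field F] {d k : ℕ} (E : Finset (Fin d → F))
    (t : Fin k → F) (v : Fin (k + 1) → E) : Prop :=
  IsChainOfType E t v ∧ Function.Injective v

/-!
Two sets `A, B ⊆ F ^ d` with `|A| * |B| > 4 * q ^ (d + 1)` always contain `x ∈ A`, `y ∈ B` with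
`‖x - y‖ = t`, for any `t ≠ 0` (`card_mul_card_le_of_forall_sqNorm_ne`). Hence any two sets of
`m > 2 * q ^ ((d + 1) / 2)` points are joined by an edge of every distance graph. A chain is then
built greedily: keep a set of at least `m` possible endpoints, take `2 * m` fresh points of `E`, and
observe that fewer than `m` of them fail to be joined to a current endpoint (`exists_chain`). All
vertices are distinct since they come from disjoint parts of `E`, and `2 * m * k` points suffice.

The edge count is a Fourier argument. Completing squares turns the Fourier coefficients of a sphere
into Salié sums when `d` is odd and Kloosterman sums when `d` is even, and both are at most `2 * √q`
in absolute value. Salié sums are evaluated explicitly (`norm_salieSum_sq_le`). For Kloosterman sums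
this is Weil's bound (`norm_kloostermanSum_sq_le`), proved here by elementary means. The `L`-function
of the Kloosterman sum is `1 + K * T + q * T ^ 2` with `K` real, and the sums over the extensions of
degree `n` are `-(α ^ n + β ^ n)` for its reciprocal roots (`kloostermanPowerSum_eq`). If the bound
failed, `α` and `β` would be real with a root of modulus larger than `√q`, so the sums over extensions
of even degree `2 * m` would exceed every constant multiple of `q ^ m`. This contradicts
`norm_kloostermanSum_le_of_card_eq_sq`, which comes from Stepanov's method
(`card_isSquare_sq_sub_C_le`) for the curves `x + e / x = y ^ q - y + c`.
-/

section

open Polynomial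

/-! ### Stepanov's method for `z ^ 2 = g ^ 2 - c` -/

/-- The substitution `Y = X ^ r` is injective on polynomials in `X` and `Y` of degree less than
`r` in `X`. -/
theorem eq_zero_of_eval_X_pow_eq_zero {K : Type*} [Field K] (r : ℕ) :
    ∀ (N : ℕ) (P : K[X][X]), P.natDegree < N → (∀ j, (P.coeff j).degree < r) →
      P.eval (X ^ r) = 0 → P = 0 := by
  intro N
  induction N with
  | zero => intro P h; omega
  | succ N ih =>
    intro P hN hdeg hP
    have h0 := divX_mul_X_add P
    have hc : P.coeff 0 = 0 := by
      have h1 : P.divX.eval (X ^ r) * X ^ r + P.coeff 0 = 0 := by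
        rw [← hP]; conv_rhs => rw [← h0]
        simp
      have h2 : (X : K[X]) ^ r ∣ P.coeff 0 :=
        ⟨-P.divX.eval (X ^ r), by linear_combination h1⟩
      exact eq_zero_of_dvd_of_degree_lt h2 (by rw [degree_X_pow]; exact hdeg 0)
    have h3 : P.divX = 0 := by
      by_cases hn : P.natDegree = 0
      · rw [eq_C_of_natDegree_eq_zero hn]; simp
      apply ih
      · rw [natDegree_divX_eq_natDegree_tsub_one]; omega
      · intro j; rw [coeff_divX]; exact hdeg _
      · have h1 : P.divX.eval (X ^ r) * X ^ r = 0 := by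
          rw [← hP]; conv_rhs => rw [← h0]
          simp [hc]
        exact (mul_eq_zero.1 h1).resolve_right (pow_ne_zero _ X_ne_zero)
    rw [← h0, h3, hc]; simp

theorem monic_sq_sub_C {K : Type*} [Field K] {g : K[X]} (hg : g.Monic)
    (hn : 0 < g.natDegree) (c : K) : (g ^ 2 - C c).Monic ∧
      (g ^ 2 - C c).natDegree = 2 * g.natDegree := by
  have h1 : (g ^ 2).natDegree = 2 * g.natDegree := by rw [hg.natDegree_pow]
  constructor
  · apply (hg.pow 2).sub_of_left
    refine lt_of_le_of_lt degree_C_le ?_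
    rw [← natDegree_pos_iff_degree_pos, h1]; omega
  · rw [natDegree_sub_C, h1]

/-- `g ^ 2 - c` is not a square in `K(X)`: otherwise it would be a square `w ^ 2` in `K[X]`, and
`(g - w) * (g + w)` would be a nonzero constant. -/
theorem sq_ne_sq_sub_C_mul_sq {K : Type*} [Field K] (h2 : (2 : K) ≠ 0) {g : K[X]}
    (hn : 0 < g.natDegree) {c : K} (hc : c ≠ 0) {u v : K[X]} (hv : v ≠ 0) :
    u ^ 2 ≠ (g ^ 2 - C c) * v ^ 2 := by
  intro h
  obtain ⟨w, rfl⟩ : v ∣ u :=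
    (UniqueFactorizationMonoid.pow_dvd_pow_iff_dvd two_ne_zero).1 ⟨g ^ 2 - C c, by rw [h, mul_comm]⟩
  have hw : w ^ 2 = g ^ 2 - C c := by
    apply mul_left_cancel₀ (pow_ne_zero 2 hv); linear_combination h
  have hm : (g - w) * (g + w) = C c := by linear_combination -hw
  have hu : IsUnit ((g - w) * (g + w)) := by rw [hm]; exact isUnit_C.2 hc.isUnit
  have d1 := natDegree_eq_zero_of_isUnit (isUnit_of_mul_isUnit_left hu)
  have d2 := natDegree_eq_zero_of_isUnit (isUnit_of_mul_isUnit_right hu)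
  have h3 : C 2 * g = (g - w) + (g + w) := by
    rw [show (C 2 : K[X]) = 2 from rfl]; ring
  have h4 : g.natDegree = (C 2 * g).natDegree := (natDegree_C_mul h2).symm
  rw [h3] at h4
  have := natDegree_add_le (g - w) (g + w)
  omega

/-- The auxiliary polynomial of Stepanov's method is nonzero. If it vanished, squaring and using
that `f ^ r` is a polynomial in `Y = X ^ r` would give `U ^ 2 = f(X) * f'(Y) * V ^ 2` as an identity
in two independent variables, and comparing leading coefficients in `Y` would make
`f = g ^ 2 - c` a square in `K(X)`. -/
theorem auxiliary_ne_zero {K : Type*} [Field K] {p s h : ℕ} [ExpChar K p]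
    (hr : p ^ s = 2 * h + 1) (h2 : (2 : K) ≠ 0) {g : K[X]} (hg : g.Monic)
    (hn : 0 < g.natDegree) (hnh : g.natDegree ≤ h) {c : K} (hc : c ≠ 0) {U V : K[X][X]}
    (hU : ∀ j, (U.coeff j).natDegree ≤ h) (hV : ∀ j, (V.coeff j).natDegree ≤ h - g.natDegree)
    (hz : U.eval (X ^ (2 * h + 1)) + (g ^ 2 - C c) ^ (h + 1) * V.eval (X ^ (2 * h + 1)) = 0) :
    U = 0 ∧ V = 0 := by
  set r := 2 * h + 1 with hrdef
  obtain ⟨hfm, hfd⟩ := monic_sq_sub_C hg hn c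
  set f := g ^ 2 - C c with hf
  set f' : K[X] := f.map (iterateFrobenius K p s) with hf'
  have hf'm : f'.Monic := hfm.map _
  have hfr : (f'.map C).eval (X ^ r) = f ^ r := by
    rw [eval_map, ← hr, ← map_iterateFrobenius_expand (p := p) f, expand_eq_comp_X_pow, map_comp]
    simp [eval₂_eq_eval_map, comp, hf']
  have hP : U ^ 2 - C f * (f'.map C) * V ^ 2 = 0 := by
    apply eq_zero_of_eval_X_pow_eq_zero r _ _ (Nat.lt_succ_self _)
    · intro j
      have b1 : ((U ^ 2).coeff j).natDegree ≤ 2 * h := by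
        rw [pow_two, coeff_mul]
        apply natDegree_sum_le_of_forall_le
        intro x _
        refine natDegree_mul_le.trans ?_
        have := hU x.1; have := hU x.2; omega
      have b2 : ∀ k, ((V ^ 2).coeff k).natDegree ≤ 2 * (h - g.natDegree) := by
        intro k
        rw [pow_two, coeff_mul]
        apply natDegree_sum_le_of_forall_le
        intro x _
        refine natDegree_mul_le.trans ?_
        have := hV x.1; have := hV x.2; omega
      have b3 : ((C f * (f'.map C) * V ^ 2).coeff j).natDegree ≤ 2 * h := by
        rw [mul_assoc, coeff_C_mul]
        refine natDegree_mul_le.trans ?_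
        have : (((f'.map C) * V ^ 2).coeff j).natDegree ≤ 2 * (h - g.natDegree) := by
          rw [coeff_mul]
          apply natDegree_sum_le_of_forall_le
          intro x _
          rw [coeff_map]
          exact (natDegree_C_mul_le _ _).trans (b2 _)
        omega
      rw [coeff_sub]
      refine lt_of_le_of_lt degree_le_natDegree ?_
      have := (natDegree_sub_le_of_le b1 b3)
      rw [max_self] at this
      exact_mod_cast (by omega : _ < r)
    · simp only [eval_sub, eval_pow, eval_mul, eval_C, hfr]
      have : U.eval (X ^ r) = -(f ^ (h + 1) * V.eval (X ^ r)) := by linear_combination hz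
      rw [this, hrdef]; ring
  have hV0 : V = 0 := by
    by_contra hne
    have hl : U ^ 2 = C f * (f'.map C) * V ^ 2 := by linear_combination hP
    have := congrArg leadingCoeff hl
    rw [leadingCoeff_pow, leadingCoeff_mul, leadingCoeff_mul, leadingCoeff_C, leadingCoeff_pow,
      (hf'm.map C).leadingCoeff, mul_one] at this
    -- The leading coefficients in `Y` satisfy `u ^ 2 = f * v ^ 2`.
    exact sq_ne_sq_sub_C_mul_sq h2 hn hc (leadingCoeff_ne_zero.2 hne) this
  refine ⟨?_, hV0⟩
  rw [hV0] at hP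
  simpa using hP

/-- The polynomial in two variables (inner `X`, outer `Y`) whose coefficient at `X ^ i * Y ^ j`
is `γ (j, i)`. -/
noncomputable def ofCoeffs {K : Type*} [Field K] {B A : ℕ} (γ : Fin B × Fin A → K) : K[X][X] :=
  ∑ x, monomial (x.1 : ℕ) (monomial (x.2 : ℕ) (γ x))

theorem ofCoeffs_coeff_coeff {K : Type*} [Field K] {B A : ℕ} (γ : Fin B × Fin A → K)
    (j : Fin B) (i : Fin A) : ((ofCoeffs γ).coeff j).coeff i = γ (j, i) := by
  unfold ofCoeffs
  simp only [finsetSum_coeff, coeff_monomial]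
  rw [Finset.sum_eq_single (j, i)]
  · simp
  · rintro ⟨j', i'⟩ _ hne
    by_cases h1 : j' = j
    · have h2 : i' ≠ i := fun h2 => hne (by rw [h1, h2])
      simp [h1, coeff_monomial, Fin.val_inj, h2]
    · simp [Fin.val_inj, h1]
  · simp

theorem eq_zero_of_ofCoeffs_eq_zero {K : Type*} [Field K] {B A : ℕ} {γ : Fin B × Fin A → K}
    (h : ofCoeffs γ = 0) : γ = 0 := by
  funext ⟨j, i⟩
  rw [← ofCoeffs_coeff_coeff γ j i, h]; simp

theorem natDegree_ofCoeffs_coeff_le {K : Type*} [Field K] {B A : ℕ}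
    (γ : Fin B × Fin (A + 1) → K) (j : ℕ) : ((ofCoeffs γ).coeff j).natDegree ≤ A := by
  unfold ofCoeffs
  simp only [finsetSum_coeff, coeff_monomial]
  apply natDegree_sum_le_of_forall_le
  intro x _
  split_ifs
  · exact (natDegree_monomial_le _).trans (by omega)
  · simp

theorem natDegree_ofCoeffs_eval_le {K : Type*} [Field K] {B A : ℕ}
    (γ : Fin B × Fin (A + 1) → K) (r : ℕ) :
    ((ofCoeffs γ).eval (X ^ r)).natDegree ≤ A + r * (B - 1) := by
  unfold ofCoeffs
  rw [eval_finsetSum]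
  apply natDegree_sum_le_of_forall_le
  intro x _
  rw [eval_monomial, ← pow_mul]
  refine natDegree_mul_le.trans (add_le_add ((natDegree_monomial_le _).trans (by omega)) ?_)
  rw [natDegree_X_pow]
  exact Nat.mul_le_mul_left _ (by omega)

/-- The one-variable polynomial with a term `γ (j, i) * X ^ (j + r * i)` for each `(j, i)`. -/
noncomputable def twistedSum {K : Type*} [Field K] (r B A : ℕ) :
    (Fin B × Fin A → K) →ₗ[K] K[X] :=
  ∑ x, (monomial (x.1 + r * x.2 : ℕ)).comp (LinearMap.proj x)

theorem natDegree_twistedSum_le {K : Type*} [Field K] {r B A : ℕ}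
    (γ : Fin B × Fin (A + 1) → K) : (twistedSum r B (A + 1) γ).natDegree ≤ B - 1 + r * A := by
  unfold twistedSum
  rw [LinearMap.sum_apply]
  apply natDegree_sum_le_of_forall_le
  intro x _
  refine (natDegree_monomial_le _).trans ?_
  have : r * (x.2 : ℕ) ≤ r * A := Nat.mul_le_mul_left _ (by omega)
  omega

/-- Raising to the power `r` at a point of the field with `r ^ 2` elements undoes the `r`-th powers
on the coefficients and turns `X ^ i * Y ^ j` at `Y = X ^ r` into `X ^ (r * i + j)`. -/
theorem ofCoeffs_eval_pow {K : Type*} [Field K] [Fintype K] {p s r B A : ℕ} [ExpChar K p]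
    (hr : p ^ s = r) (hK : Fintype.card K = r ^ 2) (γ : Fin B × Fin A → K) (y : K) :
    (((ofCoeffs fun x => γ x ^ r).eval (X ^ r)).eval y) ^ r =
      (twistedSum r B A γ).eval y := by
  have hQ : ∀ z : K, (z ^ r) ^ r = z := by
    intro z; rw [← pow_mul, ← pow_two, ← hK, FiniteField.pow_card]
  have hQ' : ∀ (z : K) (j : ℕ), ((z ^ r) ^ j) ^ r = z ^ j := by
    intro z j; rw [← pow_mul, mul_comm j r, pow_mul, hQ]
  unfold ofCoeffs twistedSum
  rw [LinearMap.sum_apply, eval_finsetSum, eval_finsetSum, eval_finsetSum]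
  conv_lhs => rw [← hr, sum_pow_char_pow, hr]
  refine Finset.sum_congr rfl fun x _ => ?_
  simp only [eval_monomial, eval_mul, eval_pow, eval_X, LinearMap.comp_apply, LinearMap.proj_apply]
  rw [mul_pow, mul_pow, hQ, hQ', pow_add, pow_mul, ← pow_mul, mul_comm (x.2 : ℕ) r, pow_mul]
  ring

/-- Stepanov's bound: over a field with `r ^ 2` elements, `f = g ^ 2 - c` takes nonzero square
values at no more than about `r ^ 2 / 2` points. The values at those points satisfy
`f ^ ((r ^ 2 - 1) / 2) = 1`. Counting coefficients gives a nonzero polynomial `G` whose `r`-th power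
agrees at those points with a combination `D (γ, δ)` that vanishes identically; as `G` has degree
about `r ^ 2 / 2`, the bound follows by counting the roots of `G`. -/
theorem card_isSquare_sq_sub_C_le {K : Type*} [Field K] [Fintype K] {p s h : ℕ} [ExpChar K p]
    (hr : p ^ s = 2 * h + 1) (hK : Fintype.card K = (2 * h + 1) ^ 2) (h2 : (2 : K) ≠ 0)
    {g : K[X]} (hg : g.Monic) (hn : 0 < g.natDegree) (hnh : g.natDegree < h) {c : K}
    (hc : c ≠ 0) (W : Finset K)
    (hW : ∀ y ∈ W, ∃ z, z ≠ 0 ∧ g.eval y ^ 2 - c = z ^ 2) :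
    W.card ≤ (h + 2 * g.natDegree) * (2 * h + 1) := by
  set r := 2 * h + 1 with hrdef
  set n := g.natDegree with hndef
  obtain ⟨hfm, hfd⟩ := monic_sq_sub_C hg hn c
  set f := g ^ 2 - C c with hf
  obtain ⟨a, rfl⟩ : ∃ a, h = n + a := ⟨h - n, by omega⟩
  set B := n + a + n with hB
  set N := B + n + r * (n + a) with hN
  let D : ((Fin B × Fin (n + a + 1) → K) × (Fin B × Fin (a + 1) → K)) →ₗ[K] K[X] :=
    (twistedSum r B (n + a + 1)).comp (LinearMap.fst K _ _) +
      (LinearMap.mulLeft K (f ^ (n + a + 1))).comp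
        ((twistedSum r B (a + 1)).comp (LinearMap.snd K _ _))
  have hD : ∀ w, D w = twistedSum r B (n + a + 1) w.1 +
      f ^ (n + a + 1) * twistedSum r B (a + 1) w.2 := fun w => rfl
  have hDdeg : ∀ w, (D w).natDegree < N := by
    intro w
    rw [hD]
    refine lt_of_le_of_lt (natDegree_add_le _ _) (max_lt ?_ ?_)
    · refine lt_of_le_of_lt (natDegree_twistedSum_le _) ?_
      omega
    · refine lt_of_le_of_lt (natDegree_mul_le.trans
        (add_le_add (natDegree_pow_le) (natDegree_twistedSum_le _))) ?_
      rw [hfd, hN, hrdef]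
      have : B - 1 + 1 = B := by omega
      nlinarith
  let Φ : ((Fin B × Fin (n + a + 1) → K) × (Fin B × Fin (a + 1) → K)) →ₗ[K] (Fin N → K) :=
    LinearMap.pi fun l => (lcoeff K (l : ℕ)).comp D
  -- There are more coefficients `γ, δ` than coefficients in the polynomial `D (γ, δ)`.
  obtain ⟨⟨γ, δ⟩, hker, hne⟩ : ∃ w ∈ LinearMap.ker Φ, w ≠ 0 := by
    apply Submodule.exists_mem_ne_zero_of_ne_bot
    apply LinearMap.ker_ne_bot_of_finrank_lt
    simp only [Module.finrank_prod, Module.finrank_fintype_fun_eq_card, Fintype.card_prod,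
      Fintype.card_fin]
    rw [hN, hrdef, hB]
    nlinarith
  have hD0 : D (γ, δ) = 0 := by
    ext l
    by_cases hl : l < N
    · exact congrFun (LinearMap.mem_ker.1 hker) ⟨l, hl⟩
    · rw [coeff_zero]
      exact coeff_eq_zero_of_natDegree_lt (lt_of_lt_of_le (hDdeg _) (by omega))
  set U := ofCoeffs fun x => γ x ^ r with hU
  set V := ofCoeffs fun x => δ x ^ r with hV
  set G := U.eval (X ^ r) + f ^ (n + a + 1) * V.eval (X ^ r) with hG
  have hG0 : G ≠ 0 := by
    intro h0
    obtain ⟨hU0, hV0⟩ := auxiliary_ne_zero (h := n + a) hr h2 hg hn (by omega) hc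
      (natDegree_ofCoeffs_coeff_le (fun x => γ x ^ r))
      (fun j => (natDegree_ofCoeffs_coeff_le (fun x => δ x ^ r) j).trans (by omega)) h0
    apply hne
    have h1 := eq_zero_of_ofCoeffs_eq_zero hU0
    have h2 := eq_zero_of_ofCoeffs_eq_zero hV0
    ext x
    · exact eq_zero_of_pow_eq_zero (congrFun h1 x)
    · exact eq_zero_of_pow_eq_zero (congrFun h2 x)
  have hroot : ∀ y ∈ W, G.eval y = 0 := by
    intro y hy
    obtain ⟨z, hz0, hz⟩ := hW y hy
    have hfy : f.eval y = z ^ 2 := by rw [← hz, hf]; simp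
    have hz1 : (z ^ 2) ^ (2 * (n + a) * (n + a + 1)) = 1 := by
      rw [← pow_mul, ← FiniteField.pow_card_sub_one_eq_one z hz0, hK]
      congr 1
      rw [hrdef]
      apply (Nat.sub_eq_of_eq_add _).symm
      ring
    have hfr : ((z ^ 2) ^ (n + a + 1)) ^ r = (z ^ 2) ^ (n + a + 1) := by
      calc ((z ^ 2) ^ (n + a + 1)) ^ r
          = (z ^ 2) ^ (2 * (n + a) * (n + a + 1)) * (z ^ 2) ^ (n + a + 1) := by
            rw [hrdef]; ring
        _ = _ := by rw [hz1, one_mul]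
    have hGr : (G.eval y) ^ r = (D (γ, δ)).eval y := by
      rw [hG, hD, eval_add, eval_add, eval_mul, eval_mul, eval_pow, hfy]
      conv_lhs => rw [← hr, add_pow_expChar_pow, hr]
      rw [mul_pow, hfr, ofCoeffs_eval_pow hr hK, ofCoeffs_eval_pow hr hK]
    rw [hD0, eval_zero] at hGr
    exact eq_zero_of_pow_eq_zero hGr
  have hcard : W.card ≤ G.natDegree := by
    classical
    refine (Finset.card_le_card (t := G.roots.toFinset) fun y hy => ?_).trans
      ((Multiset.toFinset_card_le _).trans (card_roots' G))
    rw [Multiset.mem_toFinset, mem_roots hG0]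
    exact hroot y hy
  refine hcard.trans ((natDegree_add_le _ _).trans (max_le ?_ ?_))
  · refine (natDegree_ofCoeffs_eval_le _ r).trans ?_
    have : B - 1 + 1 = B := by omega
    nlinarith
  · refine (natDegree_mul_le.trans
        (add_le_add (natDegree_pow_le) (natDegree_ofCoeffs_eval_le _ r))).trans ?_
    rw [hfd, hrdef]
    obtain ⟨b, hb⟩ : ∃ b, B = b + 1 := ⟨B - 1, by omega⟩
    rw [hb, Nat.add_sub_cancel]
    nlinarith

/-! ### Kloosterman sums over large extensions -/

/-- The Kloosterman sum `∑_{x ≠ 0} ψ(Tr(x + e / x))` over a finite extension `L` of `F`. -/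
noncomputable def kloostermanSum {F : Type*} [Field F] (ψ : AddChar F ℂ) (e : F)
    (L : Type*) [Field L] [Fintype L] [Algebra F L] : ℂ :=
  open Classical in
  ∑ x : L with x ≠ 0, ψ (Algebra.trace F L (x + algebraMap F L e * x⁻¹))

theorem degree_X_pow_sub {R : Type*} [Field R] {n : ℕ} {p : R[X]} (h : p.degree < n) :
    (X ^ n - p).degree = (n : WithBot ℕ) := by
  rw [degree_sub_eq_left_of_degree_lt (by rwa [degree_X_pow]), degree_X_pow]

/-- An upper bound for the number of points of the curve `x + e / x = y ^ q - y + c`. For fixed `y`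
this is a quadratic equation in `x` with discriminant `(y ^ q - y + c) ^ 2 - 4 * e`, so
Stepanov's bound applies. -/
theorem card_artinSchreier_points_le {L : Type*} [Field L] [Fintype L] [DecidableEq L]
    {p s h q : ℕ} [ExpChar L p]
    (hr : p ^ s = 2 * h + 1) (hL : Fintype.card L = (2 * h + 1) ^ 2) (h2 : (2 : L) ≠ 0)
    (hq1 : 1 < q) (hqh : q < h) {e : L} (he : e ≠ 0) (c : L) :
    (((Finset.univ.filter fun x : L => x ≠ 0) ×ˢ (Finset.univ : Finset L)).filter
      fun x => x.1 + e * x.1⁻¹ - x.2 ^ q + x.2 = c).card ≤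
      (2 * h + 1) ^ 2 + 4 * q * (2 * h + 1) + 4 * q := by
  set g : L[X] := X ^ q - X + C c with hg
  have hdeg : (X - C c : L[X]).degree < q := by
    rw [degree_X_sub_C]; exact_mod_cast hq1
  have hgm : g.Monic := by
    rw [hg, sub_add]; exact monic_X_pow_sub hdeg
  have hgn : g.natDegree = q := by
    rw [hg, sub_add]; exact natDegree_eq_of_degree_eq_some (degree_X_pow_sub hdeg)
  have h4 : (4 * e : L) ≠ 0 := by
    rw [show (4 : L) = 2 * 2 by norm_num]; exact mul_ne_zero (mul_ne_zero h2 h2) he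
  obtain ⟨hfm, hfd⟩ := monic_sq_sub_C hgm (by omega) (4 * e)
  set f := g ^ 2 - C (4 * e) with hf
  have hge : ∀ y, g.eval y = y ^ q - y + c := fun y => by simp [hg]
  set W : Finset L := Finset.univ.filter fun y => ∃ z, z ≠ 0 ∧ g.eval y ^ 2 - 4 * e = z ^ 2
  have hW := card_isSquare_sq_sub_C_le hr hL h2 hgm (by omega) (by omega) h4 W
    (fun y hy => (Finset.mem_filter.1 hy).2)
  set Z := f.roots.toFinset
  have hZ : Z.card ≤ 2 * q := by
    rw [← hgn, ← hfd]
    exact (Multiset.toFinset_card_le _).trans (card_roots' f)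
  set S := (((Finset.univ.filter fun x : L => x ≠ 0) ×ˢ (Finset.univ : Finset L)).filter
      fun x => x.1 + e * x.1⁻¹ - x.2 ^ q + x.2 = c)
  have hS : ∀ x ∈ S, x.1 ≠ 0 ∧ x.1 ^ 2 - g.eval x.2 * x.1 + e = 0 := by
    intro x hx
    simp only [S, Finset.mem_filter, Finset.mem_product, Finset.mem_univ, true_and, and_true] at hx
    refine ⟨hx.1, ?_⟩
    rw [hge, ← hx.2]
    field_simp [hx.1]
    ring
  have hmaps : ∀ x ∈ S, x.2 ∈ W ∪ Z := by
    intro x hx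
    obtain ⟨hx0, hx1⟩ := hS x hx
    have h5 : g.eval x.2 ^ 2 - 4 * e = (2 * x.1 - g.eval x.2) ^ 2 := by linear_combination (-4) * hx1
    by_cases hz : 2 * x.1 - g.eval x.2 = 0
    · apply Finset.mem_union_right
      rw [Multiset.mem_toFinset, mem_roots hfm.ne_zero, IsRoot, hf]
      simp only [eval_sub, eval_pow, eval_C]
      rw [h5, hz]; ring
    · exact Finset.mem_union_left _ (Finset.mem_filter.2 ⟨Finset.mem_univ _, _, hz, h5⟩)
  have hfib : ∀ y ∈ W ∪ Z, (S.filter fun x => x.2 = y).card ≤ 2 := by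
    intro y _
    set t : L[X] := X ^ 2 - (C (g.eval y) * X - C e)
    have htd : (C (g.eval y) * X - C e : L[X]).degree < (2 : ℕ) := by
      refine lt_of_le_of_lt (degree_sub_le _ _) (max_lt ?_ ?_)
      · exact lt_of_le_of_lt (degree_C_mul_X_le _) (by norm_num)
      · exact lt_of_le_of_lt degree_C_le (by norm_num)
    have htm : t.Monic := monic_X_pow_sub htd
    have ht2 : t.natDegree = 2 := natDegree_eq_of_degree_eq_some (degree_X_pow_sub htd)
    calc (S.filter fun x => x.2 = y).card ≤ t.roots.toFinset.card := by
          apply Finset.card_le_card_of_injOn Prod.fst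
          · intro x hx
            obtain ⟨hx1, hx2⟩ := Finset.mem_filter.1 (Finset.mem_coe.1 hx)
            rw [Finset.mem_coe, Multiset.mem_toFinset, mem_roots htm.ne_zero, IsRoot]
            simp only [t, eval_sub, eval_pow, eval_X, eval_mul, eval_C]
            rw [← hx2]; linear_combination (hS x hx1).2
          · intro x hx x' hx' heq
            obtain ⟨_, hx2⟩ := Finset.mem_filter.1 (Finset.mem_coe.1 hx)
            obtain ⟨_, hx2'⟩ := Finset.mem_filter.1 (Finset.mem_coe.1 hx')
            exact Prod.ext heq (hx2.trans hx2'.symm)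
      _ ≤ 2 := by rw [← ht2]; exact (Multiset.toFinset_card_le _).trans (card_roots' t)
  have := Finset.card_le_mul_card_image_of_maps_to hmaps 2 hfib
  have h6 := Finset.card_union_le W Z
  rw [hgn] at hW
  nlinarith

/-- A bound of the right order, with a constant independent of `m`, for Kloosterman sums over the
extension of degree `2 * m`. Every curve `x + e / x = y ^ q - y + c` has at most
`T = r ^ 2 + O(r)` points while the average over `c` is close to `r ^ 2`; hence the numbers of points
are close to `T` on average, and weighting them with the character of `c` produces the
Kloosterman sum. -/
theorem norm_kloostermanSum_le_of_card_eq_sq {F : Type*} [Field F] [Fintype F] {L : Type*} [Field L]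
    [Fintype L] [Algebra F L] (h2 : (2 : F) ≠ 0) {ψ : AddChar F ℂ} (hψ : ψ ≠ 1)
    {m h : ℕ} (hr : Fintype.card F ^ m = 2 * h + 1)
    (hL : Fintype.card L = (2 * h + 1) ^ 2) (hqh : Fintype.card F < h) {e : F} (he : e ≠ 0) :
    ‖kloostermanSum ψ e L‖ ≤ 9 * Fintype.card F * (2 * h + 1 : ℕ) := by
  classical
  set q := Fintype.card F with hq
  obtain ⟨p, hcp, n, hp, hpn⟩ := FiniteField.card' F
  have := Fact.mk hp
  have : CharP L p := charP_of_injective_algebraMap (algebraMap F L).injective p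
  have : ExpChar L p := ExpChar.prime hp
  have h2L : (2 : L) ≠ 0 := by
    have := (_root_.map_ne_zero (algebraMap F L)).2 h2
    rwa [map_ofNat] at this
  have heL : algebraMap F L e ≠ 0 := (_root_.map_ne_zero _).2 he
  have hr' : p ^ (n * m : ℕ) = 2 * h + 1 := by rw [pow_mul, ← hpn, hr]
  set r := 2 * h + 1
  set T := r ^ 2 + 4 * q * r + 4 * q with hT
  set P : Finset (L × L) := (Finset.univ.filter fun x : L => x ≠ 0) ×ˢ Finset.univ with hP
  set φ : L × L → L := fun x => x.1 + algebraMap F L e * x.1⁻¹ - x.2 ^ q + x.2 with hφ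
  have hM : ∀ c, (P.filter fun x => φ x = c).card ≤ T := fun c =>
    card_artinSchreier_points_le hr' hL h2L Fintype.one_lt_card hqh heL c
  have hPcard : P.card = (r ^ 2 - 1) * r ^ 2 := by
    rw [hP, Finset.card_product, Finset.card_univ, hL, Finset.filter_ne' Finset.univ (0 : L),
      Finset.card_erase_of_mem (Finset.mem_univ _), Finset.card_univ, hL]
  set Ψ : AddChar L ℂ := ψ.compAddMonoidHom (Algebra.trace F L).toAddMonoidHom with hΨdef
  have hΨ : ∀ x, Ψ x = ψ (Algebra.trace F L x) := fun x => rfl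
  have hΨ1 : Ψ ≠ 1 := by
    obtain ⟨x, hx⟩ := AddChar.ne_one_iff.1 hψ
    obtain ⟨y, rfl⟩ := Algebra.trace_surjective F L x
    exact AddChar.ne_one_iff.2 ⟨y, hx⟩
  have hΨq : ∀ y, Ψ (y ^ q) = Ψ y := by
    intro y
    rw [hΨ, hΨ, ← Algebra.trace_eq_of_algEquiv (FiniteField.frobeniusAlgEquivOfAlgebraic F L) y]
    rfl
  have hsum : ∑ c : L, ∑ x ∈ P with φ x = c, Ψ (φ x) = (r ^ 2 : ℕ) * kloostermanSum ψ e L := by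
    rw [Finset.sum_fiberwise P φ fun x => Ψ (φ x), hP, Finset.sum_product, kloostermanSum, Finset.mul_sum]
    refine Finset.sum_congr (by congr) fun x _ => ?_
    rw [Finset.sum_congr rfl (g := fun _ => ψ (Algebra.trace F L (x + algebraMap F L e * x⁻¹)))]
    · rw [Finset.sum_const, Finset.card_univ, hL, nsmul_eq_mul]
    · intro y _
      rw [hφ, ← hΨ, AddChar.map_add_eq_mul, AddChar.map_sub_eq_div, hΨq, div_mul_cancel₀]
      rw [← norm_pos_iff, AddChar.norm_apply]
      exact one_pos
  -- The constant `T` may be subtracted because a nontrivial character sums to `0`.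
  have hsum2 : (r ^ 2 : ℕ) * kloostermanSum ψ e L =
      ∑ c : L, Ψ c * (((P.filter fun x => φ x = c).card : ℂ) - T) := by
    rw [← hsum]
    simp only [mul_sub, Finset.sum_sub_distrib]
    rw [← Finset.sum_mul, AddChar.sum_eq_zero_of_ne_one hΨ1, zero_mul, sub_zero]
    refine Finset.sum_congr rfl fun c _ => ?_
    rw [Finset.sum_congr rfl (g := fun _ => Ψ c)
      (fun x hx => by rw [(Finset.mem_filter.1 hx).2]), Finset.sum_const, nsmul_eq_mul, mul_comm]
  have hr0 : (0 : ℝ) < (r : ℝ) ^ 2 := by positivity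
  have hnorm : (r : ℝ) ^ 2 * ‖kloostermanSum ψ e L‖ ≤ (r : ℝ) ^ 2 * (4 * q * r + 4 * q + 1) := by
    calc (r : ℝ) ^ 2 * ‖kloostermanSum ψ e L‖ = ‖(r ^ 2 : ℕ) * kloostermanSum ψ e L‖ := by
          rw [norm_mul, Complex.norm_natCast]; push_cast; rfl
      _ ≤ ∑ c : L, ((T : ℝ) - ((P.filter fun x => φ x = c).card : ℝ)) := by
          rw [hsum2]
          refine (norm_sum_le _ _).trans (Finset.sum_le_sum fun c _ => ?_)
          rw [norm_mul, AddChar.norm_apply, one_mul, norm_sub_rev]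
          have := hM c
          rw [← Nat.cast_sub this, Complex.norm_natCast, Nat.cast_sub this]
      _ = (r : ℝ) ^ 2 * T - P.card := by
          rw [Finset.sum_sub_distrib, Finset.sum_const, Finset.card_univ, hL, nsmul_eq_mul,
            ← Nat.cast_sum, ← Finset.card_eq_sum_card_fiberwise (f := φ) (t := Finset.univ)
            (fun _ _ => Finset.mem_coe.2 (Finset.mem_univ _))]
          push_cast; rfl
      _ = _ := by
          rw [hPcard, Nat.cast_mul, Nat.cast_sub (Nat.one_le_pow _ _ (by omega)), hT]
          push_cast; ring
  have h1 := le_of_mul_le_mul_left hnorm hr0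
  have hq0 : (1 : ℝ) ≤ q := by exact_mod_cast Fintype.card_pos
  have hr1 : (1 : ℝ) ≤ r := by exact_mod_cast (by omega : 1 ≤ r)
  nlinarith

/-! ### The `L`-function of a Kloosterman sum -/

theorem finite_monic_natDegree_eq (F : Type*) [Field F] [Finite F] (n : ℕ) :
    {f : F[X] | f.Monic ∧ f.natDegree = n}.Finite := by
  have : Finite (degreeLT F (n + 1)) :=
    Finite.of_equiv _ (degreeLTEquiv F (n + 1)).toEquiv.symm
  refine (Set.toFinite (degreeLT F (n + 1) : Set F[X])).subset fun f hf => ?_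
  rw [SetLike.mem_coe, mem_degreeLT]
  refine lt_of_le_of_lt degree_le_natDegree ?_
  rw [hf.2]
  exact_mod_cast Nat.lt_succ_self n

/-- The monic polynomials of degree `n` over a finite field. -/
noncomputable def monicsOfDegree (F : Type*) [Field F] [Finite F] (n : ℕ) : Finset F[X] :=
  (finite_monic_natDegree_eq F n).toFinset

theorem mem_monicsOfDegree {F : Type*} [Field F] [Finite F] {n : ℕ} {f : F[X]} :
    f ∈ monicsOfDegree F n ↔ f.Monic ∧ f.natDegree = n := by
  simp [monicsOfDegree]

/-- The completely multiplicative function on monic polynomials whose value at `∏ (X - xᵢ)` is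
`ψ (∑ xᵢ + e * ∑ xᵢ⁻¹)`, extended by `0` to polynomials vanishing at `0`. -/
noncomputable def kloostermanChar {F : Type*} [Field F] (ψ : AddChar F ℂ) (e : F) (f : F[X]) : ℂ :=
  open Classical in
  if f.coeff 0 = 0 then 0 else ψ (-(f.nextCoeff + e * (f.coeff 1 / f.coeff 0)))

theorem kloostermanChar_one {F : Type*} [Field F] (ψ : AddChar F ℂ) (e : F) :
    kloostermanChar ψ e 1 = 1 := by
  rw [kloostermanChar, ← C_1, nextCoeff_C_eq_zero]
  simp [coeff_one]

theorem kloostermanChar_mul {F : Type*} [Field F] (ψ : AddChar F ℂ) (e : F) {f g : F[X]}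
    (hf : f.Monic) (hg : g.Monic) :
    kloostermanChar ψ e (f * g) = kloostermanChar ψ e f * kloostermanChar ψ e g := by
  unfold kloostermanChar
  rw [mul_coeff_zero, mul_coeff_one, hf.nextCoeff_mul hg]
  by_cases h1 : f.coeff 0 = 0
  · simp [h1]
  by_cases h2 : g.coeff 0 = 0
  · simp [h2]
  rw [if_neg (mul_ne_zero h1 h2), if_neg h1, if_neg h2, ← AddChar.map_add_eq_mul]
  congr 1
  field_simp
  ring

theorem kloostermanChar_pow {F : Type*} [Field F] (ψ : AddChar F ℂ) (e : F) {f : F[X]}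
    (hf : f.Monic) (j : ℕ) : kloostermanChar ψ e (f ^ j) = kloostermanChar ψ e f ^ j := by
  induction j with
  | zero => simp [kloostermanChar_one]
  | succ j ih => rw [pow_succ, kloostermanChar_mul ψ e (hf.pow j) hf, ih, pow_succ]

/-- The coefficient of `T ^ n` in the `L`-function of `kloostermanChar ψ e`. -/
noncomputable def kloostermanCoeff {F : Type*} [Field F] [Finite F] (ψ : AddChar F ℂ) (e : F)
    (n : ℕ) : ℂ :=
  ∑ f ∈ monicsOfDegree F n, kloostermanChar ψ e f

/-- The pairs `(P, j)` with `P` a monic irreducible polynomial such that `P ^ j` has degree `k`. -/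
noncomputable def primePowerPairs (F : Type*) [Field F] [Finite F] (k : ℕ) : Finset (F[X] × ℕ) :=
  open Classical in
  (((Finset.range (k + 1)).biUnion (monicsOfDegree F)) ×ˢ Finset.range (k + 1)).filter
    fun x => Irreducible x.1 ∧ x.2 * x.1.natDegree = k

theorem mem_primePowerPairs {F : Type*} [Field F] [Finite F] {k : ℕ} (hk : k ≠ 0)
    {x : F[X] × ℕ} : x ∈ primePowerPairs F k ↔
      x.1.Monic ∧ Irreducible x.1 ∧ x.2 * x.1.natDegree = k := by
  classical
  unfold primePowerPairs
  simp only [Finset.mem_filter, Finset.mem_product, Finset.mem_biUnion, Finset.mem_range,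
    mem_monicsOfDegree]
  constructor
  · rintro ⟨⟨⟨d, hd, h1, h2⟩, h3⟩, h4, h5⟩
    exact ⟨h1, h4, h5⟩
  · rintro ⟨h1, h4, h5⟩
    have h6 : x.2 ≠ 0 := by rintro h; rw [h, zero_mul] at h5; exact hk h5.symm
    have h7 := h4.natDegree_pos
    refine ⟨⟨⟨_, ?_, h1, rfl⟩, ?_⟩, h4, h5⟩
    · rw [Nat.lt_succ_iff, ← h5]; exact Nat.le_mul_of_pos_left _ (by omega)
    · rw [Nat.lt_succ_iff, ← h5]; exact Nat.le_mul_of_pos_right _ h7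

/-- The coefficient of `T ^ k` in the logarithmic derivative of the `L`-function. -/
noncomputable def kloostermanPowerSum {F : Type*} [Field F] [Finite F] (ψ : AddChar F ℂ) (e : F)
    (k : ℕ) : ℂ :=
  ∑ x ∈ primePowerPairs F k, (x.1.natDegree : ℂ) * kloostermanChar ψ e x.1 ^ x.2

/-- The polynomial analogue of `∑_{d ∣ n} Λ(d) = log n`. -/
theorem sum_natDegree_primePowerPairs_dvd {F : Type*} [Field F] [Finite F] {n : ℕ} {f : F[X]}
    (hf : f.Monic) (hn : f.natDegree = n) :
    ∑ k ∈ Finset.Icc 1 n, ∑ x ∈ primePowerPairs F k,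
      (open Classical in if x.1 ^ x.2 ∣ f then x.1.natDegree else 0) = n := by
  classical
  have hf0 := hf.ne_zero
  set s := UniqueFactorizationMonoid.normalizedFactors f with hs
  have hmem : ∀ P ∈ s, Irreducible P ∧ P.Monic := fun P hP =>
    ⟨UniqueFactorizationMonoid.irreducible_of_normalized_factor P hP, by
      have h1 := UniqueFactorizationMonoid.normalize_normalized_factor P hP
      rw [← h1]
      exact monic_normalize
        (UniqueFactorizationMonoid.irreducible_of_normalized_factor P hP).ne_zero⟩
  have hprod : s.prod = f := by
    have h1 := UniqueFactorizationMonoid.prod_normalizedFactors hf0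
    refine eq_of_monic_of_associated ?_ hf h1
    have h2 := monic_multiset_prod_of_monic s id (fun P hP => (hmem P hP).2)
    rwa [Multiset.map_id] at h2
  have hcount : ∀ P : F[X], Irreducible P → P.Monic → ∀ j, P ^ j ∣ f ↔ j ≤ s.count P := by
    intro P hP hPm j
    rw [pow_dvd_iff_le_emultiplicity,
      UniqueFactorizationMonoid.emultiplicity_eq_count_normalizedFactors hP hf0,
      hPm.normalize_eq_self, Nat.cast_le]
  have hdeg : n = ∑ P ∈ s.toFinset, s.count P * P.natDegree := by
    rw [← hn, ← hprod, natDegree_multiset_prod_of_monic _ (fun P hP => (hmem P hP).2),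
      Finset.sum_multiset_map_count]
    rfl
  have hdeg' : n = ∑ P ∈ s.toFinset, ∑ j ∈ Finset.Icc 1 (s.count P), P.natDegree := by
    conv_lhs => rw [hdeg]
    refine Finset.sum_congr rfl fun P _ => ?_
    rw [Finset.sum_const, Nat.card_Icc, smul_eq_mul, Nat.add_sub_cancel]
  conv_rhs => rw [hdeg']
  simp_rw [← Finset.sum_filter]
  rw [Finset.sum_sigma', Finset.sum_sigma']
  refine Finset.sum_bij (fun x _ => ⟨x.2.1, x.2.2⟩) ?_ ?_ ?_ ?_
  · rintro ⟨k, P, j⟩ hx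
    simp only [Finset.mem_sigma, Finset.mem_Icc, Finset.mem_filter] at hx ⊢
    obtain ⟨⟨hk1, hkn⟩, hx, hd⟩ := hx
    obtain ⟨h1, h2, h3⟩ := (mem_primePowerPairs (by omega)).1 hx
    have hj : 1 ≤ j := by
      rcases Nat.eq_zero_or_pos j with h | h
      · simp only [h, zero_mul] at h3; omega
      · exact h
    have hj2 := (hcount P h2 h1 j).1 hd
    exact ⟨Multiset.mem_toFinset.2 (Multiset.count_pos.1 (by omega)), hj, hj2⟩
  · rintro ⟨k, P, j⟩ hx ⟨k', P', j'⟩ hx' h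
    simp only [Finset.mem_sigma, Finset.mem_Icc, Finset.mem_filter] at hx hx'
    obtain ⟨h1, h2, h3⟩ := (mem_primePowerPairs (by omega)).1 hx.2.1
    obtain ⟨h1', h2', h3'⟩ := (mem_primePowerPairs (by omega)).1 hx'.2.1
    simp only [Sigma.mk.injEq, heq_eq_eq] at h
    obtain ⟨rfl, rfl⟩ := h
    simp only at h3 h3'
    rw [← h3, ← h3']
  · rintro ⟨P, j⟩ hx
    simp only [Finset.mem_sigma, Finset.mem_Icc, Multiset.mem_toFinset] at hx
    obtain ⟨hP, hj1, hj2⟩ := hx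
    obtain ⟨h1, h2⟩ := hmem P hP
    have hdvd := (hcount P h1 h2 j).2 hj2
    have h7 := h1.natDegree_pos
    have hpos : 0 < j * P.natDegree := Nat.mul_pos (by omega) h7
    refine ⟨⟨j * P.natDegree, P, j⟩, ?_, rfl⟩
    simp only [Finset.mem_sigma, Finset.mem_Icc, Finset.mem_filter]
    refine ⟨⟨hpos, ?_⟩, (mem_primePowerPairs hpos.ne').2 ⟨h2, h1, rfl⟩, hdvd⟩
    rw [← hn, ← natDegree_pow]
    exact natDegree_le_of_dvd hdvd hf0
  · intro x _; rfl

theorem sum_kloostermanChar_dvd {F : Type*} [Field F] [Finite F] (ψ : AddChar F ℂ) (e : F)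
    {P : F[X]} (hP : P.Monic) {j k n : ℕ} (hk : j * P.natDegree = k) (hkn : k ≤ n) :
    ∑ f ∈ monicsOfDegree F n, (open Classical in if P ^ j ∣ f then kloostermanChar ψ e f else 0) =
      kloostermanChar ψ e P ^ j * kloostermanCoeff ψ e (n - k) := by
  classical
  rw [← Finset.sum_filter, kloostermanCoeff, Finset.mul_sum]
  symm
  refine Finset.sum_bij (fun h _ => P ^ j * h) ?_ ?_ ?_ ?_
  · intro h hh
    rw [mem_monicsOfDegree] at hh
    rw [Finset.mem_filter, mem_monicsOfDegree, (hP.pow j).natDegree_mul hh.1, hP.natDegree_pow]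
    exact ⟨⟨(hP.pow j).mul hh.1, by omega⟩, dvd_mul_right _ _⟩
  · intro h _ h' _ heq
    exact mul_left_cancel₀ (hP.pow j).ne_zero heq
  · intro f hf
    rw [Finset.mem_filter, mem_monicsOfDegree] at hf
    obtain ⟨⟨h1, h2⟩, h, rfl⟩ := hf
    have hm : h.Monic := (hP.pow j).of_mul_monic_left h1
    rw [(hP.pow j).natDegree_mul hm, hP.natDegree_pow] at h2
    exact ⟨h, mem_monicsOfDegree.2 ⟨hm, by omega⟩, rfl⟩
  · intro h hh
    rw [kloostermanChar_mul ψ e (hP.pow j) (mem_monicsOfDegree.1 hh).1, kloostermanChar_pow ψ e hP]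

/-- Newton's identities for the `L`-function, i.e. `T * L'(T) = (T * L'(T) / L(T)) * L(T)`
coefficientwise. -/
theorem natCast_mul_kloostermanCoeff {F : Type*} [Field F] [Finite F] (ψ : AddChar F ℂ) (e : F)
    (n : ℕ) : (n : ℂ) * kloostermanCoeff ψ e n =
      ∑ k ∈ Finset.Icc 1 n, kloostermanPowerSum ψ e k * kloostermanCoeff ψ e (n - k) := by
  classical
  have h1 : (n : ℂ) * kloostermanCoeff ψ e n = ∑ f ∈ monicsOfDegree F n,
      ∑ k ∈ Finset.Icc 1 n, ∑ x ∈ primePowerPairs F k,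
        (x.1.natDegree : ℂ) * if x.1 ^ x.2 ∣ f then kloostermanChar ψ e f else 0 := by
    rw [kloostermanCoeff, Finset.mul_sum]
    refine Finset.sum_congr rfl fun f hf => ?_
    rw [mem_monicsOfDegree] at hf
    conv_lhs => rw [← sum_natDegree_primePowerPairs_dvd hf.1 hf.2]
    push_cast
    rw [Finset.sum_mul]
    refine Finset.sum_congr rfl fun k _ => ?_
    rw [Finset.sum_mul]
    refine Finset.sum_congr rfl fun x _ => ?_
    split_ifs <;> simp
  rw [h1, Finset.sum_comm]
  refine Finset.sum_congr rfl fun k hk => ?_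
  rw [Finset.mem_Icc] at hk
  rw [Finset.sum_comm, kloostermanPowerSum, Finset.sum_mul]
  refine Finset.sum_congr rfl fun x hx => ?_
  obtain ⟨h2, h3, h4⟩ := (mem_primePowerPairs (by omega)).1 hx
  rw [← Finset.mul_sum, sum_kloostermanChar_dvd ψ e h2 h4 hk.2, mul_assoc]

theorem kloostermanCoeff_zero {F : Type*} [Field F] [Finite F] (ψ : AddChar F ℂ) (e : F) :
    kloostermanCoeff ψ e 0 = 1 := by
  have : monicsOfDegree F 0 = {1} := by
    ext f
    rw [mem_monicsOfDegree, Finset.mem_singleton]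
    constructor
    · rintro ⟨h1, h2⟩; exact h1.natDegree_eq_zero.1 h2
    · rintro rfl; exact ⟨monic_one, natDegree_one⟩
  rw [kloostermanCoeff, this, Finset.sum_singleton, kloostermanChar_one]

theorem kloostermanCoeff_two {F : Type*} [Field F] [Fintype F] {ψ : AddChar F ℂ}
    (hψ : ψ.IsPrimitive) {e : F} (he : e ≠ 0) : kloostermanCoeff ψ e 2 = Fintype.card F := by
  classical
  have h1 : kloostermanCoeff ψ e 2 = ∑ c : F, ∑ b : F,
      if c = 0 then 0 else ψ (b * (-(1 + e / c))) := by
    rw [← Finset.sum_product', kloostermanCoeff]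
    symm
    refine Finset.sum_bij (fun x _ => X ^ 2 + C x.2 * X + C x.1) ?_ ?_ ?_ ?_
    · rintro ⟨c, b⟩ _
      rw [mem_monicsOfDegree]
      refine ⟨by monicity!, by compute_degree!⟩
    · rintro ⟨c, b⟩ _ ⟨c', b'⟩ _ h
      have h0 := congrArg (fun f => coeff f 0) h
      have h1 := congrArg (fun f => coeff f 1) h
      simp [coeff_X, coeff_C] at h0 h1
      rw [h0, h1]
    · intro f hf
      rw [mem_monicsOfDegree] at hf
      refine ⟨(f.coeff 0, f.coeff 1), by simp, ?_⟩
      ext n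
      rcases n with _ | _ | _ | n
      · simp
      · simp [coeff_C]
      · have := hf.1.coeff_natDegree
        rw [hf.2] at this
        simp [this]
      · have hc : f.coeff (n + 1 + 1 + 1) = 0 :=
          coeff_eq_zero_of_natDegree_lt (by have := hf.2; omega)
        simp [hc]
    · rintro ⟨c, b⟩ _
      have hd : (X ^ 2 + C b * X + C c : F[X]).natDegree = 2 := by compute_degree!
      rw [kloostermanChar, nextCoeff_of_natDegree_pos (by rw [hd]; omega), hd]
      simp [coeff_X, coeff_C]
      split_ifs
      · rfl
      · congr 1; ring
  rw [h1, Finset.sum_eq_single (-e)]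
  · have : e / -e = -1 := by field_simp
    simp [this, he]
  · intro c _ hc
    by_cases h0 : c = 0
    · simp [h0]
    · simp only [if_neg h0]
      rw [AddChar.sum_mulShift _ hψ, if_neg]
      · exact Nat.cast_zero
      intro h
      apply hc
      field_simp at h
      linear_combination -h
  · simp

/-- The `L`-function is a polynomial of degree `2`: in degree `n ≥ 3` the coefficients at `0`, `1`
and `n - 1` are independent, so shifting the last one multiplies the sum by `ψ t ≠ 1`. -/
theorem kloostermanCoeff_eq_zero {F : Type*} [Field F] [Finite F] {ψ : AddChar F ℂ}
    (hψ : ψ ≠ 1) (e : F) {n : ℕ} (hn : 3 ≤ n) : kloostermanCoeff ψ e n = 0 := by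
  obtain ⟨t, ht⟩ := AddChar.ne_one_iff.1 hψ
  have hd : ∀ (t : F) (f : F[X]), f.Monic → f.natDegree = n →
      (f - C t * X ^ (n - 1)).Monic ∧ (f - C t * X ^ (n - 1)).natDegree = n := by
    intro t f hf hfn
    have h1 : (C t * X ^ (n - 1)).degree < f.degree := by
      rw [degree_eq_natDegree hf.ne_zero, hfn]
      refine lt_of_le_of_lt (degree_C_mul_X_pow_le _ _) ?_
      exact_mod_cast (by omega : n - 1 < n)
    exact ⟨hf.sub_of_left h1, by
      rw [natDegree_eq_of_degree_eq (degree_sub_eq_left_of_degree_lt h1), hfn]⟩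
  have h1 : kloostermanCoeff ψ e n = kloostermanCoeff ψ e n * ψ t := by
    conv_rhs => rw [kloostermanCoeff, Finset.sum_mul]
    rw [kloostermanCoeff]
    symm
    refine Finset.sum_bij (fun f _ => f - C t * X ^ (n - 1)) ?_ ?_ ?_ ?_
    · intro f hf
      rw [mem_monicsOfDegree] at hf ⊢
      exact hd t f hf.1 hf.2
    · intro f _ f' _ h
      exact sub_left_injective h
    · intro f hf
      rw [mem_monicsOfDegree] at hf
      refine ⟨f - C (-t) * X ^ (n - 1), mem_monicsOfDegree.2 (hd (-t) f hf.1 hf.2), ?_⟩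
      simp
    · intro f hf
      rw [mem_monicsOfDegree] at hf
      have h2 := hd t f hf.1 hf.2
      have c0 : (f - C t * X ^ (n - 1)).coeff 0 = f.coeff 0 := by
        rw [coeff_sub, coeff_C_mul_X_pow, if_neg (by omega), sub_zero]
      have c1 : (f - C t * X ^ (n - 1)).coeff 1 = f.coeff 1 := by
        rw [coeff_sub, coeff_C_mul_X_pow, if_neg (by omega), sub_zero]
      have c2 : (f - C t * X ^ (n - 1)).coeff (n - 1) = f.coeff (n - 1) - t := by
        rw [coeff_sub, coeff_C_mul_X_pow, if_pos rfl]
      unfold kloostermanChar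
      rw [nextCoeff_of_natDegree_pos (p := f) (by omega),
        nextCoeff_of_natDegree_pos (p := f - C t * X ^ (n - 1)) (by omega), h2.2, hf.2, c0, c1, c2]
      split_ifs
      · simp
      · rw [← AddChar.map_add_eq_mul]; congr 1; ring
  have h2 : kloostermanCoeff ψ e n * (1 - ψ t) = 0 := by linear_combination h1
  exact (mul_eq_zero.1 h2).resolve_right (sub_ne_zero.2 (Ne.symm ht))

/-! ### Sums over extensions and Weil's bound -/

theorem natDegree_minpoly_inv {F L : Type*} [Field F] [Field L] [Algebra F L]
    [FiniteDimensional F L] (x : L) : (minpoly F x⁻¹).natDegree = (minpoly F x).natDegree := by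
  rw [← IntermediateField.adjoin.finrank (.of_finite F x),
    ← IntermediateField.adjoin.finrank (.of_finite F x⁻¹)]
  have : IntermediateField.adjoin F {x⁻¹} = IntermediateField.adjoin F {x} := by
    apply le_antisymm
    · rw [IntermediateField.adjoin_simple_le_iff]
      exact inv_mem (IntermediateField.mem_adjoin_simple_self F x)
    · rw [IntermediateField.adjoin_simple_le_iff]
      simpa using inv_mem (IntermediateField.mem_adjoin_simple_self F x⁻¹)
  rw [this]

theorem nextCoeff_minpoly_inv {F L : Type*} [Field F] [Field L] [Algebra F L]
    [FiniteDimensional F L] {x : L} (hx : x ≠ 0) :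
    (minpoly F x⁻¹).nextCoeff = (minpoly F x).coeff 1 / (minpoly F x).coeff 0 := by
  have hi : IsIntegral F x := .of_finite F x
  set P := minpoly F x with hP
  have h0 : P.coeff 0 ≠ 0 := minpoly.coeff_zero_ne_zero hi hx
  have hPd : 0 < P.natDegree := minpoly.natDegree_pos hi
  have htr : P.natTrailingDegree = 0 := by
    rw [natTrailingDegree_eq_zero]; exact Or.inr h0
  have hrd : P.reverse.natDegree = P.natDegree := by
    rw [reverse_natDegree, htr, Nat.sub_zero]
  have hrl : P.reverse.leadingCoeff = P.coeff 0 := by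
    rw [reverse_leadingCoeff, trailingCoeff, htr]
  set R := C (P.coeff 0)⁻¹ * P.reverse with hR
  have hRd : R.natDegree = P.natDegree := by rw [hR, natDegree_C_mul (inv_ne_zero h0), hrd]
  have hRm : R.Monic := by
    rw [Monic, hR, leadingCoeff_mul, leadingCoeff_C, hrl, inv_mul_cancel₀ h0]
  have hRx : aeval x⁻¹ R = 0 := by
    rw [hR, map_mul]
    let := invertibleOfNonzero hx
    have h1 := (eval₂_reverse_eq_zero_iff (algebraMap F L) x P).2 (minpoly.aeval F x)
    rw [invOf_eq_inv] at h1
    rw [show aeval x⁻¹ P.reverse = 0 from h1, mul_zero]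
  have hdvd : minpoly F x⁻¹ ∣ R := minpoly.dvd F _ hRx
  have heq : minpoly F x⁻¹ = R := by
    symm
    apply eq_of_monic_of_dvd_of_natDegree_le (minpoly.monic (.of_finite F _)) hRm hdvd
    rw [hRd, natDegree_minpoly_inv]
  rw [heq, nextCoeff_of_natDegree_pos (by omega), hRd, hR, coeff_C_mul, coeff_reverse,
    revAt_le (by omega), div_eq_inv_mul]
  congr 2
  omega

theorem trace_eq_nsmul {F L : Type*} [Field F] [Field L] [Algebra F L]
    [FiniteDimensional F L] {j : ℕ} (x : L) (h : j * (minpoly F x).natDegree = Module.finrank F L) :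
    Algebra.trace F L x = j • -(minpoly F x).nextCoeff := by
  rw [trace_eq_finrank_mul_minpoly_nextCoeff, nsmul_eq_mul]
  congr 2
  have h1 := Module.finrank_mul_finrank F (IntermediateField.adjoin F {x}) L
  have hi : IsIntegral F x := .of_finite F x
  rw [IntermediateField.adjoin.finrank hi, ← h, mul_comm] at h1
  exact Nat.eq_of_mul_eq_mul_right (minpoly.natDegree_pos hi) h1

theorem kloostermanChar_minpoly_pow {F L : Type*} [Field F] [Field L] [Algebra F L]
    [FiniteDimensional F L] (ψ : AddChar F ℂ) (e : F) {x : L} (hx : x ≠ 0) {j : ℕ}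
    (h : j * (minpoly F x).natDegree = Module.finrank F L) :
    kloostermanChar ψ e (minpoly F x) ^ j =
      ψ (Algebra.trace F L (x + algebraMap F L e * x⁻¹)) := by
  have h0 := minpoly.coeff_zero_ne_zero (A := F) (.of_finite F x) hx
  rw [kloostermanChar, if_neg h0, ← AddChar.map_nsmul_eq_pow, map_add, ← Algebra.smul_def, LinearMap.map_smul,
    trace_eq_nsmul x h, trace_eq_nsmul x⁻¹ (by rw [natDegree_minpoly_inv, h]),
    nextCoeff_minpoly_inv hx]
  congr 1
  simp only [nsmul_eq_mul, smul_eq_mul]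
  ring

/-- A monic irreducible polynomial whose degree divides that of the extension `L` splits in `L`
with distinct roots, and is the minimal polynomial of each of them. -/
theorem card_minpoly_eq {F L : Type*} [Field F] [Fintype F] [Field L] [Fintype L] [DecidableEq F[X]]
    [Algebra F L] {P : F[X]} (hP : P.Monic) (hi : Irreducible P)
    (hd : P.natDegree ∣ Module.finrank F L) :
    (Finset.univ.filter fun x : L => minpoly F x = P).card = P.natDegree := by
  classical
  have hL : Nat.card F ^ Module.finrank F L = Fintype.card L := by
    rw [← Module.natCard_eq_pow_finrank, Nat.card_eq_fintype_card]
  have hdvd := hi.natDegree_dvd_iff_dvd_X_pow_card_pow_sub_X.1 hd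
  rw [hL] at hdvd
  have hs : (P.map (algebraMap F L)).Splits := by
    refine Splits.of_dvd (FiniteField.isSplittingField_sub L F).splits ?_
      (map_dvd (mapRingHom (algebraMap F L)) hdvd)
    exact Polynomial.map_ne_zero (FiniteField.X_pow_card_sub_X_ne_zero F Fintype.one_lt_card)
  rw [← card_rootSet_eq_natDegree (K := L) (PerfectField.separable_of_irreducible hi) hs,
    ← Set.toFinset_card]
  congr 1
  ext x
  rw [Finset.mem_filter, Set.mem_toFinset, mem_rootSet_of_ne hi.ne_zero]
  constructor
  · rintro ⟨_, rfl⟩; exact minpoly.aeval F x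
  · intro h; exact ⟨Finset.mem_univ _, (minpoly.eq_of_irreducible_of_monic hi h hP).symm⟩

/-- The logarithmic derivative of the `L`-function counts Kloosterman sums over extensions, by
grouping the elements of `L` according to their minimal polynomials. -/
theorem kloostermanSum_eq_kloostermanPowerSum {F L : Type*} [Field F] [Fintype F] [Field L]
    [Fintype L] [Algebra F L] (ψ : AddChar F ℂ) (e : F) :
    kloostermanSum ψ e L = kloostermanPowerSum ψ e (Module.finrank F L) := by
  classical
  set k := Module.finrank F L with hk
  have hk0 : k ≠ 0 := Module.finrank_pos.ne'
  have hdeg : ∀ x : L, (minpoly F x).natDegree ∣ k := fun x => minpoly.degree_dvd (.of_finite F x)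
  set φ : L → F[X] × ℕ := fun x => (minpoly F x, k / (minpoly F x).natDegree) with hφ
  have hj : ∀ x, k / (minpoly F x).natDegree * (minpoly F x).natDegree = k := fun x =>
    Nat.div_mul_cancel (hdeg x)
  have hmaps : ∀ x ∈ (Finset.univ : Finset L), φ x ∈ primePowerPairs F k := fun x _ =>
    (mem_primePowerPairs hk0).2 ⟨minpoly.monic (.of_finite F x),
      minpoly.irreducible (.of_finite F x), hj x⟩
  have h1 : kloostermanSum ψ e L = ∑ x : L,
      kloostermanChar ψ e (minpoly F x) ^ (k / (minpoly F x).natDegree) := by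
    rw [kloostermanSum, Finset.sum_filter]
    refine Finset.sum_congr rfl fun x _ => ?_
    split_ifs with hx
    · exact (kloostermanChar_minpoly_pow ψ e hx (hj x)).symm
    · push Not at hx
      have := hj x
      rw [hx] at this ⊢
      rw [minpoly.zero, kloostermanChar, if_pos (by simp), zero_pow]
      intro h
      rw [minpoly.zero, h, zero_mul] at this
      exact hk0 this.symm
  rw [h1, kloostermanPowerSum, ← Finset.sum_fiberwise_of_maps_to hmaps]
  refine Finset.sum_congr rfl fun y hy => ?_
  obtain ⟨P, j⟩ := y
  obtain ⟨hP, hi, hjP⟩ := (mem_primePowerPairs hk0).1 hy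
  simp only at hP hi hjP
  have hfil : (Finset.univ.filter fun x : L => φ x = (P, j)) =
      Finset.univ.filter fun x : L => minpoly F x = P := by
    refine Finset.filter_congr fun x _ => ?_
    simp only [hφ, Prod.mk.injEq, and_iff_left_iff_imp]
    rintro rfl
    rw [← hjP, Nat.mul_div_cancel _ hi.natDegree_pos]
  rw [hfil, Finset.sum_congr rfl (g := fun _ => kloostermanChar ψ e P ^ j), Finset.sum_const,
    card_minpoly_eq hP hi ⟨j, by rw [← hk, ← hjP, mul_comm]⟩, nsmul_eq_mul]
  intro x hx
  rw [(Finset.mem_filter.1 hx).2, ← hjP, Nat.mul_div_cancel _ hi.natDegree_pos]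

theorem conj_kloostermanSum {F : Type*} [Field F] [Fintype F] (ψ : AddChar F ℂ) (e : F) :
    (starRingEnd ℂ) (kloostermanSum ψ e F) = kloostermanSum ψ e F := by
  classical
  rw [kloostermanSum, map_sum]
  refine Finset.sum_bij (fun x _ => -x) ?_ ?_ ?_ ?_
  · intro x hx; simpa using hx
  · intro x _ y _ h; exact neg_injective h
  · intro x hx; exact ⟨-x, by simpa using hx, neg_neg x⟩
  · intro x _
    rw [← AddChar.map_neg_eq_conj, ← map_neg]
    congr 2
    rw [inv_neg]; ring

/-- Kloosterman sums over extensions in terms of the reciprocal roots `α, β` of the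
`L`-function `1 + K * T + q * T ^ 2`, where `K` is the sum over the base field. -/
theorem kloostermanPowerSum_eq {F : Type*} [Field F] [Fintype F] {ψ : AddChar F ℂ}
    (hψ : ψ.IsPrimitive) (hψ1 : ψ ≠ 1) {e : F} (he : e ≠ 0) {α β : ℂ}
    (h1 : α + β = -kloostermanSum ψ e F) (h2 : α * β = Fintype.card F) :
    ∀ n, 1 ≤ n → kloostermanPowerSum ψ e n = -(α ^ n + β ^ n) := by
  have hK : kloostermanPowerSum ψ e 1 = -(α + β) := by
    rw [h1, neg_neg, kloostermanSum_eq_kloostermanPowerSum, Module.finrank_self]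
  have hA1 : kloostermanCoeff ψ e 1 = -(α + β) := by
    have := natCast_mul_kloostermanCoeff ψ e 1
    simpa [kloostermanCoeff_zero, hK] using this
  have hS2 : kloostermanPowerSum ψ e 2 = -(α ^ 2 + β ^ 2) := by
    have := natCast_mul_kloostermanCoeff ψ e 2
    rw [Finset.sum_Icc_succ_top (by norm_num)] at this
    simp only [Finset.Icc_self, Finset.sum_singleton, hK, kloostermanCoeff_two hψ he,
      ← h2] at this
    norm_num [hA1, kloostermanCoeff_zero] at this
    linear_combination -this
  intro n
  induction n using Nat.strong_induction_on with
  | _ n ih =>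
    intro hn
    rcases (by omega : n = 1 ∨ n = 2 ∨ 3 ≤ n) with rfl | rfl | h3
    · rw [hK]; ring
    · exact hS2
    · obtain ⟨m, rfl⟩ : ∃ m, n = m + 3 := ⟨n - 3, by omega⟩
      have := natCast_mul_kloostermanCoeff ψ e (m + 3)
      rw [kloostermanCoeff_eq_zero hψ1 e h3, mul_zero, Finset.sum_Icc_succ_top (by omega),
        Finset.sum_Icc_succ_top (by omega), Finset.sum_Icc_succ_top (by omega),
        Finset.sum_eq_zero, show m + 3 - (m + 2 + 1) = 0 by omega,
        show m + 3 - (m + 1 + 1) = 1 by omega, show m + 3 - (m + 1) = 2 by omega,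
        kloostermanCoeff_zero, hA1, kloostermanCoeff_two hψ he, ← h2,
        ih (m + 1) (by omega) (by omega), ih (m + 1 + 1) (by omega) (by omega)] at this
      · rw [show m + 3 = m + 2 + 1 by rfl]
        linear_combination -this
      · intro k hk
        rw [Finset.mem_Icc] at hk
        rw [kloostermanCoeff_eq_zero hψ1 e (by omega), mul_zero]

/-- Weil's bound for Kloosterman sums. Real reciprocal roots of the `L`-function with product `q` and
not both of modulus `√q` would make the sums over even-degree extensions too large. -/
theorem norm_kloostermanSum_sq_le {F : Type*} [Field F] [Fintype F] (hF : ringChar F ≠ 2)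
    {ψ : AddChar F ℂ} (hψ : ψ.IsPrimitive) {e : F} (he : e ≠ 0) :
    ‖kloostermanSum ψ e F‖ ^ 2 ≤ 4 * Fintype.card F := by
  set q := Fintype.card F with hq
  have hψ1 : ψ ≠ 1 := by
    have := hψ one_ne_zero
    rwa [AddChar.mulShift_one] at this
  obtain ⟨κ, hκ⟩ := Complex.conj_eq_iff_real.1 (conj_kloostermanSum ψ e)
  rw [hκ, Complex.norm_real, Real.norm_eq_abs, sq_abs]
  by_contra hlt
  push Not at hlt
  obtain ⟨p, hcp⟩ := CharP.exists F
  have hp : Fact p.Prime := ⟨CharP.char_is_prime F p⟩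
  have hodd : q % 2 = 1 := FiniteField.odd_card_of_char_ne_two hF
  have hq1 : 1 < q := Fintype.one_lt_card
  have hq3 : 3 ≤ q := by omega
  have hbound : ∀ m, 2 ≤ m → ‖kloostermanPowerSum ψ e (2 * m)‖ ≤ 9 * q * (q : ℝ) ^ m := by
    intro m hm
    have : NeZero (2 * m) := ⟨by omega⟩
    let := Fintype.ofFinite (FiniteField.Extension F p (2 * m))
    have hodd' : q ^ m % 2 = 1 := by rw [Nat.pow_mod, hodd]; simp
    have hqm : q * q ≤ q ^ m := by
      rw [← pow_two]; exact Nat.pow_le_pow_right (by omega) hm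
    have hr : q ^ m = 2 * (q ^ m / 2) + 1 := by omega
    have hcard : Fintype.card (FiniteField.Extension F p (2 * m)) = (2 * (q ^ m / 2) + 1) ^ 2 := by
      rw [← hr, Fintype.card_eq_nat_card, FiniteField.natCard_extension, Nat.card_eq_fintype_card,
        ← pow_mul, mul_comm]
    have h1 := norm_kloostermanSum_le_of_card_eq_sq (Ring.two_ne_zero hF) hψ1 hr hcard
      (by have : 3 * q ≤ q * q := Nat.mul_le_mul_right _ hq3
          omega) he
    rw [kloostermanSum_eq_kloostermanPowerSum, FiniteField.finrank_extension, ← hr] at h1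
    exact_mod_cast h1
  -- If the bound failed, the reciprocal roots `α, β` of the `L`-function would be real.
  set D := Real.sqrt (κ ^ 2 - 4 * q) with hD
  have hD2 : D ^ 2 = κ ^ 2 - 4 * q := Real.sq_sqrt (by linarith)
  set α := (-κ + D) / 2 with hα
  set β := (-κ - D) / 2 with hβ
  have hαβ : α * β = q := by rw [hα, hβ]; linear_combination (-1 / 4) * hD2
  have hsum : α ^ 2 + β ^ 2 > 2 * q := by
    have : α ^ 2 + β ^ 2 = κ ^ 2 - 2 * q := by rw [hα, hβ]; linear_combination (1 / 2) * hD2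
    linarith
  have hS := kloostermanPowerSum_eq hψ hψ1 he (α := α) (β := β)
    (by rw [hκ, hα, hβ]; push_cast; ring) (by rw [← Complex.ofReal_mul, hαβ]; norm_cast)
  obtain ⟨ρ, hρq, hρ⟩ : ∃ ρ : ℝ, (q : ℝ) < ρ ∧ ∀ m, ρ ^ m ≤ α ^ (2 * m) + β ^ (2 * m) := by
    rcases lt_or_ge (q : ℝ) (α ^ 2) with h | h
    · refine ⟨α ^ 2, h, fun m => ?_⟩
      rw [pow_mul, pow_mul]
      have : 0 ≤ (β ^ 2) ^ m := by positivity
      linarith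
    · refine ⟨β ^ 2, by linarith, fun m => ?_⟩
      rw [pow_mul, pow_mul]
      have : 0 ≤ (α ^ 2) ^ m := by positivity
      linarith
  have hq0 : (0 : ℝ) < q := by exact_mod_cast (by omega : 0 < q)
  have hρ1 : 1 < ρ / q := by rwa [one_lt_div hq0]
  -- The power sums grow like `ρ ^ m`, but are bounded by a constant times `q ^ m`.
  obtain ⟨m, hm⟩ := pow_unbounded_of_one_lt (9 * q : ℝ) hρ1
  have hm2 : (9 * q : ℝ) < (ρ / q) ^ (m + 2) :=
    hm.trans_le (pow_le_pow_right₀ hρ1.le (by omega))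
  have h1 := hbound (m + 2) (by omega)
  rw [hS _ (by omega), norm_neg, ← Complex.ofReal_pow, ← Complex.ofReal_pow, ← Complex.ofReal_add,
    Complex.norm_real, Real.norm_eq_abs] at h1
  have h2 := (hρ (m + 2)).trans ((le_abs_self _).trans h1)
  rw [div_pow, lt_div_iff₀ (by positivity)] at hm2
  linarith

/-! ### Gauss sums and Salié sums -/

/-- The quadratic Gauss sum `∑ u, ψ (u ^ 2)`. -/
noncomputable def quadraticSum {F : Type*} [Field F] [Fintype F] (ψ : AddChar F ℂ) : ℂ :=
  ∑ u, ψ (u ^ 2)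

theorem sum_mul_sq_eq {F : Type*} [Field F] [Fintype F] [DecidableEq F] (hF : ringChar F ≠ 2)
    {ψ : AddChar F ℂ} (hψ : ψ.IsPrimitive) {s : F} (hs : s ≠ 0) :
    ∑ u, ψ (s * u ^ 2) = (quadraticChar F s : ℂ) * quadraticSum ψ := by
  have key : ∀ s : F, s ≠ 0 → ∑ u, ψ (s * u ^ 2) = ∑ v, (quadraticChar F v : ℂ) * ψ (v * s) := by
    intro s hs
    have h0 : ∑ v, ψ (v * s) = 0 := by rw [AddChar.sum_mulShift s hψ, if_neg hs, Nat.cast_zero]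
    rw [← add_zero (∑ v, (quadraticChar F v : ℂ) * ψ (v * s)), ← h0, ← Finset.sum_add_distrib,
      ← Finset.sum_fiberwise Finset.univ (fun u : F => u ^ 2)]
    refine Finset.sum_congr rfl fun v _ => ?_
    rw [Finset.sum_congr rfl (g := fun _ => ψ (v * s))
      (fun x hx => by rw [(Finset.mem_filter.1 hx).2, mul_comm]), Finset.sum_const, nsmul_eq_mul]
    have h1 := quadraticChar_card_sqrts hF v
    have h2 : {x : F | x ^ 2 = v}.toFinset = Finset.univ.filter fun u : F => u ^ 2 = v := by
      ext; simp
    rw [h2] at h1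
    rw [← Int.cast_natCast (R := ℂ), h1]
    push_cast; ring
  have h1 := key 1 one_ne_zero
  simp only [one_mul, mul_one] at h1
  rw [key s hs, quadraticSum, h1, Finset.mul_sum]
  refine Fintype.sum_equiv (Equiv.mulRight₀ s hs) _ _ fun v => ?_
  rw [Equiv.mulRight₀_apply, map_mul (quadraticChar F)]
  have h2 : (quadraticChar F s : ℂ) * quadraticChar F s = 1 := by
    rw [← pow_two]; exact_mod_cast quadraticChar_sq_one hs
  push_cast
  linear_combination (-(quadraticChar F v : ℂ) * ψ (v * s)) * h2

theorem norm_quadraticSum_sq {F : Type*} [Field F] [Fintype F] (hF : ringChar F ≠ 2)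
    {ψ : AddChar F ℂ} (hψ : ψ.IsPrimitive) : ‖quadraticSum ψ‖ ^ 2 = Fintype.card F := by
  classical
  have h2 := Ring.two_ne_zero hF
  have h : quadraticSum ψ * (starRingEnd ℂ) (quadraticSum ψ) = (Fintype.card F : ℂ) := by
    unfold quadraticSum
    rw [map_sum, Finset.sum_mul_sum, Finset.sum_comm]
    have : ∀ v : F, ∑ u, ψ (u ^ 2) * (starRingEnd ℂ) (ψ (v ^ 2)) =
        ∑ t, ψ (t ^ 2) * ψ (v * (2 * t)) := by
      intro v
      refine (Fintype.sum_equiv (Equiv.addRight v) _ _ fun t => ?_).symm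
      rw [Equiv.coe_addRight, ← AddChar.map_neg_eq_conj, ← AddChar.map_add_eq_mul,
        ← AddChar.map_add_eq_mul]
      congr 1; ring
    simp_rw [this]
    rw [Finset.sum_comm]
    simp_rw [← Finset.mul_sum, AddChar.sum_mulShift _ hψ]
    rw [Finset.sum_eq_single 0]
    · simp
    · intro t _ ht
      rw [if_neg (mul_ne_zero h2 ht), Nat.cast_zero, mul_zero]
    · simp
  rw [Complex.mul_conj, Complex.normSq_eq_norm_sq] at h
  exact_mod_cast h

/-- The finite field version of the Fourier transform of a Gaussian. -/
theorem sum_quadratic_eq {F : Type*} [Field F] [Fintype F] [DecidableEq F] (hF : ringChar F ≠ 2)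
    {ψ : AddChar F ℂ} (hψ : ψ.IsPrimitive) {s : F} (hs : s ≠ 0) (z : F) :
    ∑ u, ψ (-u ^ 2 / (4 * s) + z * u) =
      (quadraticChar F (-s) : ℂ) * quadraticSum ψ * ψ (s * z ^ 2) := by
  have h2 := Ring.two_ne_zero hF
  have h4 : (4 : F) = 2 * 2 := by norm_num
  have h1 : ∑ u, ψ (-u ^ 2 / (4 * s) + z * u) =
      (∑ u, ψ (-s * u ^ 2)) * ψ (s * z ^ 2) := by
    rw [Finset.sum_mul]
    -- Substitute `u = 2 s w + 2 s z`, which completes the square.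
    symm
    refine Fintype.sum_equiv ((Equiv.mulRight₀ (2 * s) (mul_ne_zero h2 hs)).trans
      (Equiv.addRight (2 * s * z))) _ _ fun w => ?_
    rw [← AddChar.map_add_eq_mul]
    congr 1
    simp only [Equiv.trans_apply, Equiv.mulRight₀_apply, Equiv.coe_addRight]
    rw [h4]
    field_simp
    ring
  rw [h1, sum_mul_sq_eq hF hψ (neg_ne_zero.2 hs)]

theorem card_sq_eq_le_two {F : Type*} [Field F] [Fintype F] [DecidableEq F]
    (hF : ringChar F ≠ 2) (c : F) : (Finset.univ.filter fun y : F => y ^ 2 = c).card ≤ 2 := by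
  have h1 := quadraticChar_card_sqrts hF c
  have h2 : {x : F | x ^ 2 = c}.toFinset = Finset.univ.filter fun u : F => u ^ 2 = c := by
    ext; simp
  rw [h2] at h1
  have h3 : quadraticChar F c ≤ 1 := by
    by_cases hc : c = 0
    · simp [hc]
    · rcases quadraticChar_dichotomy hc with h | h <;> simp [h]
  omega

/-- The bound for Salié sums, which follows from their explicit evaluation. -/
theorem norm_salieSum_sq_le {F : Type*} [Field F] [Fintype F] [DecidableEq F]
    (hF : ringChar F ≠ 2) {ψ : AddChar F ℂ} (hψ : ψ.IsPrimitive) {t : F} (ht : t ≠ 0) (b : F) :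
    ‖∑ s : F with s ≠ 0, (quadraticChar F s : ℂ) * ψ (t * s + b / s)‖ ^ 2 ≤
      4 * Fintype.card F := by
  have h2 := Ring.two_ne_zero hF
  have h4 : (4 : F) ≠ 0 := by rw [show (4 : F) = 2 * 2 by norm_num]; exact mul_ne_zero h2 h2
  set T := ∑ s : F with s ≠ 0, (quadraticChar F s : ℂ) * ψ (t * s + b / s) with hT
  set G := quadraticSum ψ
  set q := Fintype.card F with hq
  have hψ0 : ∑ y, ψ y = 0 := by
    have := AddChar.sum_mulShift (1 : F) hψ
    simpa using this
  have key : (quadraticChar F (-t) : ℂ) * G * T =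
      q * ∑ y : F with y ^ 2 = 4 * t * b, ψ y := by
    calc (quadraticChar F (-t) : ℂ) * G * T
        = ∑ s : F with s ≠ 0, ∑ y, ψ y * ψ (s⁻¹ * (b - y ^ 2 / (4 * t))) := by
          rw [hT, Finset.mul_sum]
          refine Finset.sum_congr rfl fun s hs => ?_
          have hs0 : s ≠ 0 := (Finset.mem_filter.1 hs).2
          have h5 := sum_quadratic_eq hF hψ (mul_ne_zero ht hs0) 1
          rw [show -(t * s) = -t * s by ring, map_mul (quadraticChar F)] at h5
          push_cast at h5
          calc _ = (quadraticChar F (-t) : ℂ) * quadraticChar F s * G * ψ (t * s * 1 ^ 2) *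
                ψ (b / s) := by
                rw [AddChar.map_add_eq_mul, one_pow, mul_one]; ring
            _ = _ := by
                rw [← h5, Finset.sum_mul]
                refine Finset.sum_congr rfl fun y _ => ?_
                rw [← AddChar.map_add_eq_mul, ← AddChar.map_add_eq_mul]
                congr 1
                field_simp
                ring
      _ = ∑ w : F with w ≠ 0, ∑ y, ψ y * ψ (w * (b - y ^ 2 / (4 * t))) := by
          refine Finset.sum_bij (fun s _ => s⁻¹) ?_ ?_ ?_ ?_
          · intro s hs; simpa using hs
          · intro s _ s' _ h; exact inv_injective h
          · intro s hs; exact ⟨s⁻¹, by simpa using hs, inv_inv s⟩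
          · intro s _; rfl
      -- The term `w = 0` contributes `∑ y, ψ y = 0`.
      _ = ∑ w : F, ∑ y, ψ y * ψ (w * (b - y ^ 2 / (4 * t))) := by
          refine Finset.sum_subset (Finset.filter_subset _ _) fun w _ hw => ?_
          have : w = 0 := by simpa using hw
          simp [this, hψ0]
      _ = _ := by
          rw [Finset.sum_comm, Finset.mul_sum, Finset.sum_filter]
          refine Finset.sum_congr rfl fun y _ => ?_
          rw [← Finset.mul_sum, AddChar.sum_mulShift _ hψ]
          have : b - y ^ 2 / (4 * t) = 0 ↔ y ^ 2 = 4 * t * b := by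
            rw [sub_eq_zero, eq_div_iff (mul_ne_zero h4 ht)]
            constructor <;> intro h <;> linear_combination -h
          simp only [this]
          split_ifs
          · ring
          · simp
  have hη : ‖(quadraticChar F (-t) : ℂ)‖ = 1 := by
    rcases quadraticChar_dichotomy (neg_ne_zero.2 ht) with h | h <;> simp [h]
  have hG : ‖G‖ ^ 2 = q := norm_quadraticSum_sq hF hψ
  have hq0 : (0 : ℝ) < q := by exact_mod_cast Fintype.card_pos
  have hR : ‖∑ y : F with y ^ 2 = 4 * t * b, ψ y‖ ≤ 2 := by
    refine (norm_sum_le _ _).trans ?_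
    simp only [AddChar.norm_apply, Finset.sum_const, nsmul_eq_mul, mul_one]
    exact_mod_cast card_sq_eq_le_two hF (4 * t * b)
  have h6 := congrArg (fun z => ‖z‖ ^ 2) key
  simp only [norm_mul, mul_pow, hη, hG, Complex.norm_natCast, one_mul] at h6
  have h7 : ‖∑ y : F with y ^ 2 = 4 * t * b, ψ y‖ ^ 2 ≤ 2 ^ 2 :=
    pow_le_pow_left₀ (norm_nonneg _) hR 2
  have h8 : (q : ℝ) * ‖T‖ ^ 2 ≤ q * (4 * q) := by
    rw [h6]; nlinarith [mul_le_mul_of_nonneg_left h7 (sq_nonneg (q : ℝ))]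
  exact le_of_mul_le_mul_left h8 hq0

/-- A uniform bound for the exponential sums that occur as Fourier coefficients of spheres:
Kloosterman sums (or the sum `-1`) in even dimension, Salié sums in odd dimension. -/
theorem norm_sum_quadraticChar_pow_sq_le {F : Type*} [Field F] [Fintype F] [DecidableEq F]
    (hF : ringChar F ≠ 2) {ψ : AddChar F ℂ} (hψ : ψ.IsPrimitive) {t : F} (ht : t ≠ 0) (b : F)
    (d : ℕ) :
    ‖∑ s : F with s ≠ 0, (quadraticChar F s : ℂ) ^ d * ψ (t * s + b / s)‖ ^ 2 ≤
      4 * Fintype.card F := by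
  have hsq : ∀ s : F, s ≠ 0 → (quadraticChar F s : ℂ) ^ 2 = 1 := fun s hs => by
    exact_mod_cast quadraticChar_sq_one hs
  rcases Nat.even_or_odd' d with ⟨k, rfl | rfl⟩
  · have h1 : ∑ s : F with s ≠ 0, (quadraticChar F s : ℂ) ^ (2 * k) * ψ (t * s + b / s) =
        ∑ s : F with s ≠ 0, ψ (s + t * b * s⁻¹) := by
      refine Finset.sum_bij (fun s _ => t * s) ?_ ?_ ?_ ?_
      · intro s hs; simpa [ht] using hs
      · intro s _ s' _ h; exact mul_left_cancel₀ ht h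
      · intro s hs; exact ⟨t⁻¹ * s, by simpa [ht] using hs, by field_simp⟩
      · intro s hs
        have hs0 : s ≠ 0 := (Finset.mem_filter.1 hs).2
        rw [pow_mul, hsq s hs0, one_pow, one_mul]
        congr 2
        field_simp
    rw [h1]
    by_cases hb : b = 0
    · have h2 : ∑ s : F with s ≠ 0, ψ (s + t * b * s⁻¹) = -1 := by
        have := AddChar.sum_mulShift (1 : F) hψ
        simp only [mul_one, one_ne_zero, if_false, Nat.cast_zero] at this
        rw [Finset.filter_ne', ← Finset.sum_erase_add _ _ (Finset.mem_univ (0 : F))] at *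
        simp only [hb, mul_zero, zero_mul, add_zero]
        rw [AddChar.map_zero_eq_one] at this
        linear_combination this
      rw [h2]
      have : (1 : ℝ) ≤ Fintype.card F := by exact_mod_cast Fintype.card_pos
      norm_num
      linarith
    · have := norm_kloostermanSum_sq_le hF hψ (mul_ne_zero ht hb)
      convert this using 4
      rw [kloostermanSum]
      refine Finset.sum_congr (by congr) fun x _ => ?_
      rw [Algebra.trace_self_apply]; rfl
  · refine le_of_eq_of_le ?_ (norm_salieSum_sq_le hF hψ ht b)
    congr 2
    refine Finset.sum_congr rfl fun s hs => ?_
    rw [pow_succ, pow_mul, hsq s (Finset.mem_filter.1 hs).2, one_pow, one_mul]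

/-! ### Fourier analysis on `F ^ d` -/

theorem addChar_map_sum {ι A M : Type*} [AddCommMonoid A] [CommMonoid M] (ψ : AddChar A M)
    (s : Finset ι) (f : ι → A) : ψ (∑ i ∈ s, f i) = ∏ i ∈ s, ψ (f i) := by
  classical
  induction s using Finset.induction_on with
  | empty => simp
  | insert a s ha ih => rw [Finset.sum_insert ha, Finset.prod_insert ha, AddChar.map_add_eq_mul, ih]

/-- The Fourier transform of a Gaussian in dimension `d`, as a product of one-dimensional ones. -/
theorem sum_sqNorm_eq {F : Type*} [Field F] [Fintype F] [DecidableEq F] (hF : ringChar F ≠ 2)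
    {ψ : AddChar F ℂ} (hψ : ψ.IsPrimitive) {s : F} (hs : s ≠ 0) {d : ℕ} (z : Fin d → F) :
    ∑ m : Fin d → F, ψ (sqNorm m / (4 * s) + ∑ i, m i * z i) =
      (quadraticChar F s : ℂ) ^ d * quadraticSum ψ ^ d * ψ (-s * sqNorm z) := by
  have h1 : ∀ m : Fin d → F, ψ (sqNorm m / (4 * s) + ∑ i, m i * z i) =
      ∏ i, ψ (-(m i) ^ 2 / (4 * -s) + z i * m i) := by
    intro m
    rw [← addChar_map_sum, Finset.sum_add_distrib, sqNorm, Finset.sum_div]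
    congr 2
    · refine Finset.sum_congr rfl fun i _ => ?_
      rw [mul_neg, neg_div_neg_eq]
    · exact Finset.sum_congr rfl fun i _ => mul_comm _ _
  have h2 := Finset.prod_univ_sum (fun _ : Fin d => (Finset.univ : Finset F))
    (fun i u => ψ (-u ^ 2 / (4 * -s) + z i * u))
  rw [Fintype.piFinset_univ] at h2
  simp_rw [h1]
  rw [← h2]
  simp_rw [sum_quadratic_eq hF hψ (neg_ne_zero.2 hs), neg_neg]
  rw [Finset.prod_mul_distrib, Finset.prod_const, Finset.card_univ, Fintype.card_fin, mul_pow,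
    sqNorm, Finset.mul_sum, addChar_map_sum]

/-- Orthogonality of the characters of `F ^ d`. -/
theorem sum_dotProduct_eq {F : Type*} [Field F] [Fintype F] [DecidableEq F]
    {ψ : AddChar F ℂ} (hψ : ψ.IsPrimitive) {d : ℕ} (z : Fin d → F) :
    ∑ m : Fin d → F, ψ (∑ i, m i * z i) = if z = 0 then (Fintype.card F : ℂ) ^ d else 0 := by
  have h2 := Finset.prod_univ_sum (fun _ : Fin d => (Finset.univ : Finset F))
    (fun i u => ψ (u * z i))
  rw [Fintype.piFinset_univ] at h2
  simp_rw [addChar_map_sum]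
  rw [← h2]
  simp_rw [AddChar.sum_mulShift _ hψ]
  split_ifs with hz
  · simp [hz]
  · obtain ⟨i, hi⟩ := Function.ne_iff.1 hz
    exact Finset.prod_eq_zero (Finset.mem_univ i) (by
      rw [if_neg (by simpa using hi), Nat.cast_zero])

/-- Parseval's identity for the indicator function of `A`. -/
theorem sum_norm_sq_fourier {F : Type*} [Field F] [Fintype F]
    {ψ : AddChar F ℂ} (hψ : ψ.IsPrimitive) {d : ℕ} (A : Finset (Fin d → F)) :
    ∑ m : Fin d → F, ‖∑ x ∈ A, ψ (∑ i, m i * x i)‖ ^ 2 = (Fintype.card F : ℝ) ^ d * A.card := by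
  classical
  have h : ∑ m : Fin d → F, (∑ x ∈ A, ψ (∑ i, m i * x i)) *
      (starRingEnd ℂ) (∑ x ∈ A, ψ (∑ i, m i * x i)) = (Fintype.card F : ℂ) ^ d * A.card := by
    have h1 : ∀ m : Fin d → F, (∑ x ∈ A, ψ (∑ i, m i * x i)) *
        (starRingEnd ℂ) (∑ x ∈ A, ψ (∑ i, m i * x i)) =
        ∑ x ∈ A, ∑ y ∈ A, ψ (∑ i, m i * (x - y) i) := by
      intro m
      rw [map_sum, Finset.sum_mul_sum]
      refine Finset.sum_congr rfl fun x _ => Finset.sum_congr rfl fun y _ => ?_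
      rw [← AddChar.map_neg_eq_conj, ← AddChar.map_add_eq_mul, ← sub_eq_add_neg,
        ← Finset.sum_sub_distrib]
      simp only [Pi.sub_apply, mul_sub]
    simp_rw [h1]
    rw [Finset.sum_comm]
    have h2 : ∀ x ∈ A, ∑ m : Fin d → F, ∑ y ∈ A, ψ (∑ i, m i * (x - y) i) =
        (Fintype.card F : ℂ) ^ d := by
      intro x hx
      rw [Finset.sum_comm]
      simp_rw [sum_dotProduct_eq hψ, sub_eq_zero]
      rw [Finset.sum_ite_eq, if_pos hx]
    rw [Finset.sum_congr rfl h2, Finset.sum_const, nsmul_eq_mul, mul_comm]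
  simp_rw [Complex.mul_conj, Complex.normSq_eq_norm_sq] at h
  exact_mod_cast h

/-- Two sets without a pair of points at distance `t` satisfy `|A| * |B| ≤ 4 * q ^ (d + 1)`.
The number of such pairs is expanded into additive characters of `t - ‖x - y‖`; the trivial
character contributes the main term `|A| * |B| / q`, and the others are bounded by the estimate
for the exponential sums `c m`, the Cauchy-Schwarz inequality and Parseval's identity. -/
theorem card_mul_card_le_of_forall_sqNorm_ne {F : Type*} [Field F] [Fintype F]
    (hF : ringChar F ≠ 2) {d : ℕ} {t : F} (ht : t ≠ 0) {A B : Finset (Fin d → F)}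
    (hAB : ∀ x ∈ A, ∀ y ∈ B, sqNorm (x - y) ≠ t) :
    A.card * B.card ≤ 4 * Fintype.card F ^ (d + 1) := by
  classical
  let ψ := AddChar.FiniteField.primitiveChar_to_Complex F
  have hψ : ψ.IsPrimitive := AddChar.FiniteField.primitiveChar_to_Complex_isPrimitive F
  have h4 : (4 : F) ≠ 0 := by
    rw [show (4 : F) = 2 * 2 by norm_num]
    exact mul_ne_zero (Ring.two_ne_zero hF) (Ring.two_ne_zero hF)
  set q := Fintype.card F with hq
  set G := quadraticSum ψ with hG
  set hat : Finset (Fin d → F) → (Fin d → F) → ℂ := fun A m => ∑ x ∈ A, ψ (∑ i, m i * x i)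
  set c : (Fin d → F) → ℂ := fun m =>
    ∑ s : F with s ≠ 0, (quadraticChar F s : ℂ) ^ d * ψ (t * s + sqNorm m / 4 / s) with hc
  have hcm : ∀ m, ‖c m‖ ^ 2 ≤ 4 * q := fun m => norm_sum_quadraticChar_pow_sq_le hF hψ ht _ d
  have hpair : ∀ x ∈ A, ∀ y ∈ B, -G ^ d = ∑ m, c m * ψ (∑ i, m i * (x - y) i) := by
    intro x hx y hy
    have h1 : ∑ s : F, ψ (s * (t - sqNorm (x - y))) = 0 := by
      rw [AddChar.sum_mulShift _ hψ, if_neg (sub_ne_zero.2 (hAB x hx y hy).symm), Nat.cast_zero]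
    have h2 : ∑ s : F with s ≠ 0, ψ (s * (t - sqNorm (x - y))) = -1 := by
      rw [Finset.filter_ne']
      rw [← Finset.sum_erase_add _ _ (Finset.mem_univ (0 : F)), zero_mul,
        AddChar.map_zero_eq_one] at h1
      linear_combination h1
    calc -G ^ d = ∑ s : F with s ≠ 0, G ^ d * ψ (s * (t - sqNorm (x - y))) := by
          rw [← Finset.mul_sum, h2]; ring
      _ = ∑ s : F with s ≠ 0, ∑ m : Fin d → F, (quadraticChar F s : ℂ) ^ d *
            ψ (t * s + sqNorm m / 4 / s) * ψ (∑ i, m i * (x - y) i) := by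
          refine Finset.sum_congr rfl fun s hs => ?_
          have hs0 : s ≠ 0 := (Finset.mem_filter.1 hs).2
          have h3 : (quadraticChar F s : ℂ) ^ d * (quadraticChar F s : ℂ) ^ d = 1 := by
            rw [← mul_pow, ← pow_two]
            have : (quadraticChar F s : ℂ) ^ 2 = 1 := by exact_mod_cast quadraticChar_sq_one hs0
            rw [this, one_pow]
          calc G ^ d * ψ (s * (t - sqNorm (x - y)))
              = (quadraticChar F s : ℂ) ^ d * ψ (t * s) * ((quadraticChar F s : ℂ) ^ d * G ^ d *
                  ψ (-s * sqNorm (x - y))) := by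
                rw [show s * (t - sqNorm (x - y)) = t * s + -s * sqNorm (x - y) by ring,
                  AddChar.map_add_eq_mul]
                linear_combination (-(G ^ d * ψ (t * s) * ψ (-s * sqNorm (x - y)))) * h3
            _ = _ := by
                rw [← sum_sqNorm_eq hF hψ hs0, Finset.mul_sum]
                refine Finset.sum_congr rfl fun m _ => ?_
                rw [AddChar.map_add_eq_mul, AddChar.map_add_eq_mul, div_div]
                ring
      _ = _ := by
          rw [Finset.sum_comm]
          exact Finset.sum_congr rfl fun m _ => by rw [hc, Finset.sum_mul]
  have hmain : (A.card * B.card : ℂ) * -G ^ d =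
      ∑ m, c m * (hat A m * (starRingEnd ℂ) (hat B m)) := by
    calc (A.card * B.card : ℂ) * -G ^ d = ∑ x ∈ A, ∑ y ∈ B, -G ^ d := by
          simp only [Finset.sum_const, nsmul_eq_mul]; ring
      _ = ∑ x ∈ A, ∑ y ∈ B, ∑ m, c m * ψ (∑ i, m i * (x - y) i) :=
          Finset.sum_congr rfl fun x hx => Finset.sum_congr rfl fun y hy => hpair x hx y hy
      _ = ∑ m, ∑ x ∈ A, ∑ y ∈ B, c m * ψ (∑ i, m i * (x - y) i) := by
          rw [Finset.sum_comm]
          rw [Finset.sum_congr rfl fun x _ => Finset.sum_comm]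
          rw [Finset.sum_comm]
          exact Finset.sum_congr rfl fun m _ => Finset.sum_comm
      _ = _ := by
          refine Finset.sum_congr rfl fun m _ => ?_
          simp only [hat]
          rw [map_sum, Finset.sum_mul_sum, Finset.mul_sum]
          refine Finset.sum_congr rfl fun x _ => ?_
          rw [Finset.mul_sum]
          refine Finset.sum_congr rfl fun y _ => ?_
          rw [← AddChar.map_neg_eq_conj, ← AddChar.map_add_eq_mul, ← sub_eq_add_neg,
            ← Finset.sum_sub_distrib]
          simp only [Pi.sub_apply, mul_sub]
  have hq0 : (0 : ℝ) < q := by exact_mod_cast Fintype.card_pos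
  have hGd : (‖G‖ ^ d) ^ 2 = (q : ℝ) ^ d := by
    rw [← pow_mul, mul_comm, pow_mul, norm_quadraticSum_sq hF hψ]
  have hnorm : (A.card * B.card : ℝ) * ‖G‖ ^ d ≤
      Real.sqrt (4 * q) * ∑ m, ‖hat A m‖ * ‖hat B m‖ := by
    have h1 := congrArg norm hmain
    rw [norm_mul, norm_mul, norm_neg, norm_pow, Complex.norm_natCast, Complex.norm_natCast] at h1
    rw [h1, Finset.mul_sum]
    refine (norm_sum_le _ _).trans (Finset.sum_le_sum fun m _ => ?_)
    rw [norm_mul, norm_mul, RCLike.norm_conj]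
    exact mul_le_mul_of_nonneg_right (Real.le_sqrt_of_sq_le (hcm m)) (by positivity)
  have hCS : (∑ m, ‖hat A m‖ * ‖hat B m‖) ^ 2 ≤
      ((q : ℝ) ^ d * A.card) * ((q : ℝ) ^ d * B.card) := by
    refine (Finset.sum_mul_sq_le_sq_mul_sq _ _ _).trans (le_of_eq ?_)
    rw [sum_norm_sq_fourier hψ, sum_norm_sq_fourier hψ]
  have hsq := pow_le_pow_left₀ (by positivity) hnorm 2
  rw [mul_pow, mul_pow (Real.sqrt _), hGd, Real.sq_sqrt (by positivity)] at hsq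
  have hfin : (A.card * B.card : ℝ) * ((A.card * B.card) * (q : ℝ) ^ d) ≤
      (A.card * B.card : ℝ) * (4 * (q : ℝ) ^ (d + 1) * (q : ℝ) ^ d) := by
    have := mul_le_mul_of_nonneg_left hCS (by positivity : (0 : ℝ) ≤ 4 * q)
    calc _ = (A.card * B.card : ℝ) ^ 2 * (q : ℝ) ^ d := by ring
      _ ≤ _ := hsq.trans this
      _ = _ := by ring
  rcases Nat.eq_zero_or_pos (A.card * B.card) with h0 | h0
  · rw [h0]; exact Nat.zero_le _
  · have h0' : (0 : ℝ) < A.card * B.card := by exact_mod_cast h0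
    have h1 := le_of_mul_le_mul_right (le_of_mul_le_mul_left hfin h0')
      (by positivity : (0 : ℝ) < (q : ℝ) ^ d)
    exact_mod_cast h1

end

/-! ### Chains -/

theorem snoc_chain {α : Type*} [DecidableEq α] {k : ℕ} {r : Fin (k + 1) → α → α → Prop}
    {E₁ E₂ : Finset α} (hE : Disjoint E₁ E₂) {v : Fin (k + 1) → α} (hv : ∀ i, v i ∈ E₁)
    (hinj : Function.Injective v) (hr : ∀ i : Fin k, r i.castSucc (v i.castSucc) (v i.succ))
    {y : α} (hy : y ∈ E₂) (hvy : r (Fin.last k) (v (Fin.last k)) y) :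
    (∀ i, (Fin.snoc v y : Fin (k + 2) → α) i ∈ E₁ ∪ E₂) ∧
      Function.Injective (Fin.snoc v y : Fin (k + 2) → α) ∧
      ∀ i : Fin (k + 1), r i ((Fin.snoc v y : Fin (k + 2) → α) i.castSucc)
        ((Fin.snoc v y : Fin (k + 2) → α) i.succ) := by
  refine ⟨fun i => ?_, ?_, fun i => ?_⟩
  · refine Fin.lastCases ?_ (fun i => ?_) i
    · rw [Fin.snoc_last]; exact Finset.mem_union_right _ hy
    · rw [Fin.snoc_castSucc]; exact Finset.mem_union_left _ (hv i)
  · refine Fin.snoc_injective_iff.2 ⟨hinj, ?_⟩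
    rintro ⟨i, rfl⟩
    exact Finset.disjoint_left.1 hE (hv i) hy
  · refine Fin.lastCases ?_ (fun i => ?_) i
    · rw [Fin.snoc_castSucc, Fin.succ_last, Fin.snoc_last]; exact hvy
    · rw [Fin.snoc_castSucc, Fin.succ_castSucc, Fin.snoc_castSucc]; exact hr i

/-- Suppose that, for each of the relations `r i`, any two sets of size at least `m` contain a
related pair. Then in a set of size `m + 2 * m * k` at least `m` points are endpoints of
non-overlapping chains. Each step takes `2 * m` fresh points; fewer than `m` of them are
unrelated to all of the at least `m` previous endpoints. -/
theorem exists_chain_endpoints {α : Type*} [DecidableEq α] {m : ℕ} : ∀ (k : ℕ)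
    (r : Fin k → α → α → Prop)
    (_ : ∀ i (A B : Finset α), m ≤ A.card → m ≤ B.card → ∃ x ∈ A, ∃ y ∈ B, r i x y)
    (E : Finset α), m + 2 * m * k ≤ E.card →
    ∃ R : Finset α, m ≤ R.card ∧ ∀ x ∈ R, ∃ v : Fin (k + 1) → α, v (Fin.last k) = x ∧
      (∀ i, v i ∈ E) ∧ Function.Injective v ∧ ∀ i : Fin k, r i (v i.castSucc) (v i.succ) := by
  classical
  intro k
  induction k with
  | zero =>
    intro r hr E hE
    exact ⟨E, by omega, fun x hx => ⟨fun _ => x, rfl, fun _ => hx,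
      fun _ _ _ => Subsingleton.elim (α := Fin 1) _ _, fun i => i.elim0⟩⟩
  | succ k ih =>
    intro r hr E hE
    obtain ⟨E₁, hE₁, hcard⟩ := Finset.exists_subset_card_eq
      (show m + 2 * m * k ≤ E.card by nlinarith)
    obtain ⟨R₁, hR₁, hR⟩ := ih (fun i => r i.castSucc) (fun i => hr i.castSucc) E₁ hcard.ge
    have hc2 : 2 * m ≤ (E \ E₁).card := by
      rw [Finset.card_sdiff_of_subset hE₁, hcard]
      have : 2 * m * (k + 1) = 2 * m * k + 2 * m := by ring
      omega
    set R := (E \ E₁).filter fun y => ∃ x ∈ R₁, r (Fin.last k) x y with hRdef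
    refine ⟨R, ?_, ?_⟩
    · by_contra hlt
      have h1 : R ⊆ E \ E₁ := Finset.filter_subset _ _
      have h2 : m ≤ ((E \ E₁) \ R).card := by
        rw [Finset.card_sdiff_of_subset h1]; omega
      obtain ⟨x, hx, y, hy, hxy⟩ := hr (Fin.last k) R₁ _ hR₁ h2
      rw [Finset.mem_sdiff] at hy
      exact hy.2 (Finset.mem_filter.2 ⟨hy.1, x, hx, hxy⟩)
    · intro y hy
      obtain ⟨hyE, x, hx, hxy⟩ := Finset.mem_filter.1 hy
      obtain ⟨v, hvx, hv, hinj, hvr⟩ := hR x hx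
      obtain ⟨h1, h2, h3⟩ := snoc_chain Finset.disjoint_sdiff hv hinj hvr hyE (hvx ▸ hxy)
      rw [Finset.union_sdiff_of_subset hE₁] at h1
      exact ⟨_, Fin.snoc_last _ _, h1, h2, h3⟩

/-- The last step of the chain needs only `m` fresh points. -/
theorem exists_chain {α : Type*} [DecidableEq α] {m k : ℕ} (r : Fin (k + 1) → α → α → Prop)
    (hr : ∀ i (A B : Finset α), m ≤ A.card → m ≤ B.card → ∃ x ∈ A, ∃ y ∈ B, r i x y)
    (E : Finset α) (hE : 2 * m * (k + 1) ≤ E.card) :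
    ∃ v : Fin (k + 2) → α, (∀ i, v i ∈ E) ∧ Function.Injective v ∧
      ∀ i : Fin (k + 1), r i (v i.castSucc) (v i.succ) := by
  have h2m : 2 * m * (k + 1) = m + 2 * m * k + m := by ring
  obtain ⟨E₁, hE₁, hcard⟩ := Finset.exists_subset_card_eq
    (show m + 2 * m * k ≤ E.card by omega)
  obtain ⟨R, hR, hRv⟩ := exists_chain_endpoints k (fun i => r i.castSucc)
    (fun i => hr i.castSucc) E₁ hcard.ge
  obtain ⟨x, hx, y, hy, hxy⟩ := hr (Fin.last k) R (E \ E₁) hR (by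
    rw [Finset.card_sdiff_of_subset hE₁, hcard]; omega)
  obtain ⟨v, hvx, hv, hinj, hvr⟩ := hRv x hx
  obtain ⟨h1, h2, h3⟩ := snoc_chain Finset.disjoint_sdiff hv hinj hvr hy (hvx ▸ hxy)
  rw [Finset.union_sdiff_of_subset hE₁] at h1
  exact ⟨_, h1, h2, h3⟩

theorem corollary1 {F : Type*} [Field F] [Fintype F] (hF : ringChar F ≠ 2)
    (d k : ℕ) (hd : 2 ≤ d) (hk : 1 ≤ k) (E : Finset (Fin d → F))
    (hE : (4 * (k : ℝ) / Real.log 2) * (Fintype.card F : ℝ) ^ (((d : ℝ) + 1) / 2) ≤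
      (E.card : ℝ)) :
    ∀ t : Fin k → F, (∀ i, t i ≠ 0) →
      ∃ v : Fin (k + 1) → E, IsNonOverlappingChain E t v := by
  classical
  intro t ht
  obtain ⟨k, rfl⟩ : ∃ j, k = j + 1 := ⟨k - 1, by omega⟩
  set q := Fintype.card F with hq
  have hq2 : (2 : ℝ) ≤ q := by exact_mod_cast Fintype.one_lt_card (α := F)
  set Y := (q : ℝ) ^ (((d : ℝ) + 1) / 2) with hY
  have hY2 : Y ^ 2 = (q : ℝ) ^ (d + 1) := by
    rw [hY, ← Real.rpow_natCast, ← Real.rpow_mul (by linarith), ← Real.rpow_natCast]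
    congr 1
    push_cast; ring
  have hYpos : 0 ≤ Y := by positivity
  have hY' : 2 ≤ Y := by
    have h1 : (q : ℝ) ^ 2 ≤ q ^ (d + 1) := pow_le_pow_right₀ (by linarith) (by omega)
    nlinarith
  set m := ⌊2 * Y⌋₊ + 1 with hm
  have hm1 : 2 * Y < m := by rw [hm]; push_cast; exact Nat.lt_floor_add_one _
  have hm2 : (m : ℝ) ≤ 2 * Y + 1 := by
    rw [hm]; push_cast; linarith [Nat.floor_le (by linarith : 0 ≤ 2 * Y)]
  have hedge : ∀ i (A B : Finset (Fin d → F)), m ≤ A.card → m ≤ B.card →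
      ∃ x ∈ A, ∃ y ∈ B, sqNorm (x - y) = t i := by
    intro i A B hA hB
    by_contra! hcon
    have h1 := card_mul_card_le_of_forall_sqNorm_ne hF (ht i) hcon
    have h2 : (m : ℝ) * m ≤ 4 * Y ^ 2 := by
      rw [hY2]; exact_mod_cast (Nat.mul_le_mul hA hB).trans h1
    nlinarith
  have hlog : 0 < Real.log 2 := Real.log_pos one_lt_two
  -- Since `2 / log 2 > 5 / 2` and `Y ≥ 2`, the constant leaves room to round `2 * Y` up to `m`.
  have hlogY : 2 * Y + 1 ≤ 2 * Y / Real.log 2 := by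
    rw [le_div_iff₀ hlog]
    nlinarith [Real.log_two_lt_d9]
  have hcard : 2 * m * (k + 1) ≤ E.card := by
    have h1 : (2 * m * (k + 1) : ℝ) ≤ E.card := by
      refine le_trans ?_ hE
      calc (2 * m * (k + 1) : ℝ) ≤ 2 * (2 * Y / Real.log 2) * (k + 1) := by
            have := hm2.trans hlogY
            gcongr
        _ = _ := by push_cast; ring
    exact_mod_cast h1
  obtain ⟨v, hv, hinj, hvr⟩ := exists_chain (fun i x y => sqNorm (x - y) = t i) hedge E hcard
  refine ⟨fun i => ⟨v i, hv i⟩, fun i => ⟨fun h => ?_, hvr i⟩, fun i j h => ?_⟩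
  · exact (Fin.castSucc_lt_succ (i := i)).ne (hinj (congrArg Subtype.val h))
  · exact hinj (congrArg Subtype.val h)
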